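/- Let $n\ge 3$ and let $\lambda=(a,b)$ be a two-row partition of $n$, i.e. $a\ge b\ge 1$ and $a+b=n$. For $k\in\mathbb Z$ let $\overline{k}$ be the element of $\{1,\dots,n\}$ congruent to $k$ modulo $n$. For $x,y\in\{1,\dots,n\}$ let $[\![x,y]\!]$ be the cyclic interval $\{x,\overline{x+1},\dots,y\}$, with the convention $[\![x,y]\!]=\emptyset$ if $x=\overline{y+1}$. *The graph $\overline\Gamma_\lambda=(V,m,\tau)$.* The vertex set $V=\mathrm{RSYT}(\lambda)$ is the set of row-standard Young tableaux of shape $\lambda$: fillings $s$ of the Young diagram of $\lambda$ by $1,\dots,n$, each used once, with increasing rows. Write $s^1,s^2$ for the sets of entries of the first (upper) and the second (lower) row. Put $$\tau(s)=\overline{\mathrm{des}}(s)=\{i\in\{1,\dots,n\} : i\in s^1,\ \overline{i+1}\in s^2\}.$$ For $s,t\in V$ set $m(s\triangleright t)=1$ if there is a move from $s$ to $t$, and $m(s\triangleright t)=0$ otherwise. The moves from $s$ to $t$ are of two kinds; in both, $t$ is obtained from $s$ by interchanging two entries and re-sorting the rows. 1. (First kind) $t$ is obtained by interchanging $i$ and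 $\overline{i+1}$ for some $i\in s^1$ with $\overline{i+1}\in s^2$. 2. (Second kind) $t$ is obtained by interchanging $i$ and $j$ for some $i\in s^2$ and $j\in s^1$ with $i\ne\overline{j+1}$ such that (a) $\overline{j-i}$ is odd; (b) $\overline{i+1}\in s^1$ and $\overline{j-1}\in s^2$; (c) $\overline{i-1}\in s^1$ or $\overline{j+1}\in s^2$; (d) $\#\big(s^2\cap[\![\overline{j-1-2k},\overline{j-2}]\!]\big)\ge k$ for every integer $k$ with $1\le k\le(\overline{j-i}-3)/2$; (e) if $j\neq\overline{i+1}$, then $\#\big(s^2\cap[\![\overline{i+2},\overline{j-2}]\!]\big)=(\overline{j-i}-3)/2$. *The Hecke algebra.* Let $\overline{\mathcal S}_n$ be the affine symmetric group, i.e. the group of bijections $w:\mathbb Z\to\mathbb Z$ with $w(i+n)=w(i)+n$ for all $i$ and $\sum_{i=1}^n w(i)=n(n+1)/2$. It is a Coxeter group with simple reflections $s_i$, $i\in\{1,\dots,n\}$, where $s_i$ interchanges $x$ and $x+1$ for all $x\equiv i\pmod n$ and fixes all other integers. Let $\mathcal H$ be its Iwahori–Hecke algebra over $\mathbb Z[q^{\pm1/2}]$: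 the algebra generated by $T_1,\dots,T_n$ subject to $(T_i-q)(T_i+1)=0$ and the braid relations $T_iT_jT_i\cdots=T_jT_iT_j\cdots$, where each side has as many factors as the order of $s_is_j$. **Theorem.** $\overline\Gamma_\lambda$ is a $W$-graph for $W=\overline{\mathcal S}_n$. That is, the formulas $$T_i(u)=\begin{cases} q\,u & \text{if } i\notin\tau(u),\\ -u+q^{1/2}\displaystyle\sum_{v\in V:\ i\notin\tau(v)} m(u\triangleright v)\,v & \text{if } i\in\tau(u),\end{cases}\qquad u\in V,\ 1\le i\le n,$$ define an $\mathcal H$-module structure on the free module $\bigoplus_{v\in V}\mathbb Z[q^{\pm1/2}]\,v$. -/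

import Mathlib

noncomputable section

/-! ### The affine symmetric group -/

/-- For a bijection `w` of `ℤ` commuting with translation by `n ≥ 1`, the values
`w 1, …, w n` represent every residue class modulo `n` exactly once. -/
theorem sum_Icc_residue {n : ℕ} [NeZero n] (w : Equiv.Perm ℤ)
    (hw : ∀ i : ℤ, w (i + n) = w i + n) (F : ZMod n → ℤ) :
    ∑ i ∈ Finset.Icc (1 : ℤ) n, F ((w i : ℤ) : ZMod n) = ∑ c : ZMod n, F c := by
  have hk : ∀ (k i : ℤ), w (i + k * n) = w i + k * n := by
    intro k
    induction k with
    | zero => intro i; simp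
    | succ k ih =>
      intro i
      have h := hw (i + k * n)
      rw [ih] at h
      calc w (i + ((k : ℤ) + 1) * n) = w (i + k * n + n) := by ring_nf
        _ = w i + (k + 1) * n := by rw [h]; ring
    | pred k ih =>
      intro i
      have h := hw (i + (-(k : ℤ) - 1) * n)
      have e : i + (-(k : ℤ) - 1) * n + n = i + -(k : ℤ) * n := by ring
      rw [e, ih] at h
      linarith
  have hinj : Set.InjOn (fun i : ℤ => ((w i : ℤ) : ZMod n)) (Finset.Icc (1 : ℤ) n) := by
    intro i hi j hj hij
    simp only [Finset.coe_Icc, Set.mem_Icc] at hi hj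
    have hij' := (ZMod.intCast_eq_intCast_iff_dvd_sub _ _ _).1 hij
    obtain ⟨k, hk'⟩ := hij'
    have h1 : w j = w (i + k * n) := by rw [hk]; linarith
    have h2 := w.injective h1
    have hn : (0 : ℤ) < n := by exact_mod_cast Nat.pos_of_ne_zero (NeZero.ne n)
    have hk0 : k = 0 := by
      have a1 : k < 1 := by by_contra hc; push Not at hc; nlinarith
      have a2 : -1 < k := by by_contra hc; push Not at hc; nlinarith
      omega
    subst hk0
    simpa using h2.symm
  have himg : (Finset.Icc (1 : ℤ) n).image (fun i : ℤ => ((w i : ℤ) : ZMod n)) = Finset.univ := by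
    apply Finset.eq_univ_of_card
    rw [Finset.card_image_of_injOn hinj, ZMod.card]
    simp
  rw [← himg, Finset.sum_image hinj]

/-- If `f` is `n`-periodic then its sum over `w 1, …, w n` does not depend on `w`. -/
theorem sum_Icc_periodic {n : ℕ} (w : Equiv.Perm ℤ)
    (hw : ∀ i : ℤ, w (i + n) = w i + n) (f : ℤ → ℤ) (F : ZMod n → ℤ)
    (hf : ∀ i : ℤ, f i = F (i : ZMod n)) :
    ∑ i ∈ Finset.Icc (1 : ℤ) n, f (w i) = ∑ i ∈ Finset.Icc (1 : ℤ) n, f i := by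
  rcases Nat.eq_zero_or_pos n with h0 | h0
  · subst h0; simp
  · have : NeZero n := ⟨by omega⟩
    simp only [hf]
    rw [sum_Icc_residue w hw F]
    exact (sum_Icc_residue (Equiv.refl ℤ) (fun _ => rfl) F).symm

/-- The displacement of a bijection commuting with translation by `n` is `n`-periodic. -/
theorem exists_displacement {n : ℕ} (w : Equiv.Perm ℤ) (hw : ∀ i : ℤ, w (i + n) = w i + n) :
    ∃ F : ZMod n → ℤ, ∀ i : ℤ, w i - i = F (i : ZMod n) := by
  have hper : Function.Periodic (fun i : ℤ => w i - i) (n : ℤ) := by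
    intro i
    simp only [hw]
    ring
  refine ⟨fun c => w c.cast - c.cast, fun i => ?_⟩
  have h1 : (((i : ZMod n).cast : ℤ) : ZMod n) = (i : ZMod n) := ZMod.intCast_zmod_cast _
  obtain ⟨k, hk⟩ := (ZMod.intCast_eq_intCast_iff_dvd_sub _ _ _).1 h1
  have h2 : i = ((i : ZMod n).cast : ℤ) + k * n := by linarith
  have h3 : w (((i : ZMod n).cast : ℤ) + k * n) - (((i : ZMod n).cast : ℤ) + k * n) =
      w ((i : ZMod n).cast : ℤ) - ((i : ZMod n).cast : ℤ) :=
    hper.int_mul k ((i : ZMod n).cast : ℤ)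
  rw [← h2] at h3
  exact h3

/-- The affine symmetric group: bijections `w` of `ℤ` with `w (i + n) = w i + n` for all `i`
and `w 1 + ⋯ + w n = 1 + ⋯ + n = n (n + 1) / 2`. -/
def affineSymmetricGroup (n : ℕ) : Subgroup (Equiv.Perm ℤ) where
  carrier := {w | (∀ i : ℤ, w (i + n) = w i + n) ∧
    ∑ i ∈ Finset.Icc (1 : ℤ) n, w i = ∑ i ∈ Finset.Icc (1 : ℤ) n, i}
  one_mem' := ⟨fun _ => rfl, rfl⟩
  mul_mem' := by
    rintro v w ⟨hv, hv'⟩ ⟨hw, hw'⟩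
    refine ⟨fun i => by simp [hw, hv], ?_⟩
    obtain ⟨F, hF⟩ := exists_displacement v hv
    have h := sum_Icc_periodic w hw (fun i => v i - i) F hF
    simp only [Finset.sum_sub_distrib] at h
    simp only [Equiv.Perm.coe_mul, Function.comp_apply]
    linarith
  inv_mem' := by
    rintro w ⟨hw, hw'⟩
    have hi : ∀ i : ℤ, w⁻¹ (i + n) = w⁻¹ i + n := by
      intro i
      apply w.injective
      rw [hw]
      simp
    refine ⟨hi, ?_⟩
    obtain ⟨F, hF⟩ := exists_displacement w⁻¹ hi
    have h := sum_Icc_periodic w hw (fun i => w⁻¹ i - i) F hF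
    simp only [Finset.sum_sub_distrib, Equiv.Perm.inv_def, Equiv.symm_apply_apply] at h ⊢
    linarith

/-- The map `ℤ → ℤ` underlying the simple reflection `s_i`: it interchanges `x` and `x + 1`
for every `x ≡ i` modulo `n`, and fixes all other integers. -/
def simpleReflectionFun (n : ℕ) (i : ZMod n) (x : ℤ) : ℤ :=
  if (x : ZMod n) = i then x + 1 else if (x : ZMod n) = i + 1 then x - 1 else x

theorem simpleReflectionFun_involutive {n : ℕ} (hn : 3 ≤ n) (i : ZMod n) :
    Function.Involutive (simpleReflectionFun n i) := by
  have : Fact (1 < n) := ⟨by omega⟩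
  have h1 : i + 1 ≠ i := by simp
  intro x
  unfold simpleReflectionFun
  by_cases hx : (x : ZMod n) = i
  · simp [hx]
  · by_cases hx' : (x : ZMod n) = i + 1
    · simp [hx']
    · simp [hx, hx']

/-- The simple reflections `s_i` of the affine symmetric group, indexed by `i ∈ ℤ/n`
(so that `s_0 = s_n`). -/
def simpleReflection {n : ℕ} (hn : 3 ≤ n) (i : ZMod n) : affineSymmetricGroup n :=
  ⟨Function.Involutive.toPerm (simpleReflectionFun n i) (simpleReflectionFun_involutive hn i), by
    have : Fact (1 < n) := ⟨by omega⟩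
    have : NeZero n := ⟨by omega⟩
    have h1 : i + 1 ≠ i := by simp
    refine ⟨fun x => ?_, ?_⟩
    · simp only [Function.Involutive.coe_toPerm, simpleReflectionFun, Int.cast_add,
        Int.cast_natCast, CharP.cast_eq_zero, add_zero]
      split_ifs <;> ring
    · rw [← sub_eq_zero, ← Finset.sum_sub_distrib]
      have key : ∀ x : ℤ, simpleReflectionFun n i x - x =
          (fun c : ZMod n => (if c = i then (1 : ℤ) else 0) + if c = i + 1 then -1 else 0) x := by
        intro x
        simp only [simpleReflectionFun]
        by_cases hx : (x : ZMod n) = i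
        · simp [hx]
        · by_cases hx' : (x : ZMod n) = i + 1
          · simp [hx']
          · simp [hx, hx']
      simp only [Function.Involutive.coe_toPerm]
      rw [Finset.sum_congr rfl (fun x _ => key x)]
      have h := sum_Icc_residue (n := n) (Equiv.refl ℤ) (fun _ => rfl)
        (fun c : ZMod n => (if c = i then (1 : ℤ) else 0) + if c = i + 1 then -1 else 0)
      simp only [Equiv.refl_apply] at h
      refine h.trans ?_
      rw [Finset.sum_add_distrib]
      simp⟩

/-! ### Iwahori–Hecke algebras and `W`-graphs -/

/-- The ring `ℤ[q^{1/2}, q^{-1/2}]`, where `q^{k/2}` is `LaurentPolynomial.T k`. -/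
abbrev QRing : Type := LaurentPolynomial ℤ

/-- The element `q^{1/2}`. -/
def qHalf : QRing := LaurentPolynomial.T 1

/-- The element `q`. -/
def qVar : QRing := LaurentPolynomial.T 2

/-- The alternating product `x y x ⋯` with `m` factors. -/
def altProd {A : Type*} [Monoid A] (x y : A) : ℕ → A
  | 0 => 1
  | m + 1 => x * altProd y x m

/-- Relations of the Iwahori–Hecke algebra of a Coxeter group `W` with simple reflections `s`:
the braid relations `T_i T_j T_i ⋯ = T_j T_i T_j ⋯` with as many factors on each side as the
order of `s_i s_j` (a trivial relation if this order is infinite, where `orderOf` is `0`), and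
the quadratic relations `(T_i - q) (T_i + 1) = 0`. The latter make each `T_i` invertible. -/
inductive HeckeRel {I W : Type*} [Group W] (s : I → W) :
    FreeAlgebra QRing I → FreeAlgebra QRing I → Prop
  | braid (i j : I) : HeckeRel s
      (altProd (FreeAlgebra.ι QRing i) (FreeAlgebra.ι QRing j) (orderOf (s i * s j)))
      (altProd (FreeAlgebra.ι QRing j) (FreeAlgebra.ι QRing i) (orderOf (s i * s j)))
  | quadratic (i : I) : HeckeRel s
      ((FreeAlgebra.ι QRing i - algebraMap QRing (FreeAlgebra QRing I) qVar) *
        (FreeAlgebra.ι QRing i + 1)) 0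

/-- The Iwahori–Hecke algebra over `ℤ[q^{±1/2}]` of the Coxeter group `W` with simple
reflections `s`. -/
abbrev HeckeAlgebra {I W : Type*} [Group W] (s : I → W) : Type _ := RingQuot (HeckeRel s)

/-- The generator `T_i` of the Iwahori–Hecke algebra. -/
def heckeT {I W : Type*} [Group W] (s : I → W) (i : I) : HeckeAlgebra s :=
  RingQuot.mkAlgHom QRing (HeckeRel s) (FreeAlgebra.ι QRing i)

/-- An `I`-labeled graph with vertex set `V`; `m u v` is the weight of the edge `u → v`. -/
structure LabeledGraph (I V : Type*) where
  m : V → V → QRing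
  τ : V → Set I
  locallyFinite : ∀ v, {w | m v w ≠ 0 ∨ m w v ≠ 0}.Finite

namespace LabeledGraph

variable {I V : Type*}

open Classical in
/-- The value `T_i(u)` in the free module on `V`, for a vertex `u`. -/
def actOnVertex (Γ : LabeledGraph I V) (i : I) (u : V) : V →₀ QRing :=
  if i ∈ Γ.τ u then
    -Finsupp.single u 1 +
      qHalf • ∑ᶠ (v : V) (_ : i ∉ Γ.τ v), Γ.m u v • Finsupp.single v (1 : QRing)
  else qVar • Finsupp.single u 1

/-- The `ℤ[q^{±1/2}]`-linear operator on the free module on `V` extending `actOnVertex`. -/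
def operator (Γ : LabeledGraph I V) (i : I) : Module.End QRing (V →₀ QRing) :=
  Finsupp.linearCombination QRing (Γ.actOnVertex i)

/-- `Γ` is a `W`-graph: there is a module structure over the Iwahori–Hecke algebra on the free
`ℤ[q^{±1/2}]`-module on `V` in which each `T_i` acts by `Γ.operator i`. -/
def IsWGraph {W : Type*} [Group W] (s : I → W) (Γ : LabeledGraph I V) : Prop :=
  ∃ ρ : HeckeAlgebra s →ₐ[QRing] Module.End QRing (V →₀ QRing),
    ∀ i, ρ (heckeT s i) = Γ.operator i

end LabeledGraph

/-! ### Row-standard tableaux with two rows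

The set `{1, …, n}` is identified with `ℤ/n`; the residue class of `k` stands for the unique
element of `{1, …, n}` congruent to `k`. -/

/-- The representative in `{1, …, n}` of a residue class modulo `n`. -/
def rep {n : ℕ} (k : ZMod n) : ℕ := if k = 0 then n else k.val

/-- The cyclic interval from `x` to `y`, which is empty if `x = y + 1`. -/
def cycInterval {n : ℕ} (x y : ZMod n) : Set (ZMod n) :=
  {z | x ≠ y + 1 ∧ ∃ k : ℕ, k ≤ (y - x).val ∧ z = x + k}

/-- Row-standard Young tableaux with first row of length `a`, second row of length `b` and
entries `1, …, n`, each occurring exactly once. -/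
@[ext]
structure RSYT (n a b : ℕ) where
  first : Fin a → ZMod n
  second : Fin b → ZMod n
  first_increasing : StrictMono (fun k => rep (first k))
  second_increasing : StrictMono (fun k => rep (second k))
  bijective : Function.Bijective (Sum.elim first second)

namespace RSYT

variable {n a b : ℕ}

theorem finite (n a b : ℕ) : Finite (RSYT n a b) := by
  rcases isEmpty_or_nonempty (RSYT n a b) with h | ⟨⟨T⟩⟩
  · infer_instance
  · have : Finite (ZMod n) := Finite.of_surjective _ T.bijective.2
    refine Finite.of_injective
      (fun s : RSYT n a b => ((s.first, s.second) : (Fin a → ZMod n) × (Fin b → ZMod n))) ?_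
    intro s t hst
    exact RSYT.ext (congrArg Prod.fst hst) (congrArg Prod.snd hst)

/-- The set of entries of the first (upper) row. -/
def row₁ (s : RSYT n a b) : Set (ZMod n) := Set.range s.first

/-- The set of entries of the second (lower) row. -/
def row₂ (s : RSYT n a b) : Set (ZMod n) := Set.range s.second

/-- The affine descent set: those `i` in a strictly higher row than `i + 1`. -/
def affineDes (s : RSYT n a b) : Set (ZMod n) := {i | i ∈ s.row₁ ∧ i + 1 ∈ s.row₂}

/-- `t` is obtained from `s` by interchanging `x` and `y` and reordering each row. -/
def Interchange (s t : RSYT n a b) (x y : ZMod n) : Prop :=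
  t.row₁ = Equiv.swap x y '' s.row₁ ∧ t.row₂ = Equiv.swap x y '' s.row₂

/-- There is a move of the first kind from `s` to `t`. -/
def FirstMove (s t : RSYT n a b) : Prop :=
  ∃ i : ZMod n, i ∈ s.row₁ ∧ i + 1 ∈ s.row₂ ∧ Interchange s t i (i + 1)

/-- There is a move of the second kind from `s` to `t`. In the last two conditions the bounds
`1 ≤ k ≤ (rep (j - i) - 3) / 2` and the value `(rep (j - i) - 3) / 2` are written without
subtraction and division. -/
def SecondMove (s t : RSYT n a b) : Prop :=
  ∃ i j : ZMod n, i ∈ s.row₂ ∧ j ∈ s.row₁ ∧ i ≠ j + 1 ∧ Interchange s t i j ∧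
    Odd (rep (j - i)) ∧
    (i + 1 ∈ s.row₁ ∧ j - 1 ∈ s.row₂) ∧
    (i - 1 ∈ s.row₁ ∨ j + 1 ∈ s.row₂) ∧
    (∀ k : ℕ, 1 ≤ k → 2 * k + 3 ≤ rep (j - i) →
      k ≤ (s.row₂ ∩ cycInterval (j - 1 - 2 * (k : ZMod n)) (j - 2)).ncard) ∧
    (j ≠ i + 1 → 2 * (s.row₂ ∩ cycInterval (i + 2) (j - 2)).ncard + 3 = rep (j - i))

end RSYT

open Classical in
/-- The labeled graph on the row-standard tableaux of shape `(a, b)`: `τ` is the affine descent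
set, and `m u v` is `1` if there is a move from `u` to `v` and `0` otherwise. -/
def affineTwoRowGraph (n a b : ℕ) : LabeledGraph (ZMod n) (RSYT n a b) where
  m u v := if RSYT.FirstMove u v ∨ RSYT.SecondMove u v then 1 else 0
  τ := RSYT.affineDes
  locallyFinite := fun _ => by
    have := RSYT.finite n a b
    exact Set.toFinite _

end

/-! A tableau is read as a cyclic word in parentheses: entries of the first row open (`true`),
entries of the second row close (`false`), and `i` is a descent exactly when `()` stands at `i, i +
1`. Matching the parentheses around the circle gives an affine cup diagram, on which the
Temperley–Lieb generator at `i` acts by attaching a cap. On words without the descent `i` this is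
the partial function `Cap i`: it turns `)(` into `()`, and it turns `((` or `))` into `()` by
flipping the letter at `i + 1`, respectively at `i`, together with its mate; it is undefined if that
mate is missing.

Conditions (a), (b), (d), (e) on a second move say exactly that the two interchanged positions are
matched in the target (`matched_toggle_iff`), and (c) says that the source has a descent ending or
starting at one of them. Hence the moves from `s` to `t` that remove the descent `i` are exactly the
instances of `Cap i t.word s.word` (`RSYT.move_iff_cap`).

Let `L_i` be the diagonal matrix of the descent `i` and `E_i` the 0-1 matrix of `Cap i`. Then `T_i -
q` has matrix `A_i = -(1 + q) L_i + q^{1/2} E_i`, the transpose of a Temperley–Lieb action. The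
Hecke relations follow from `A_i² = -(1 + q) A_i`, from `A_i A_j A_i = q A_i` for adjacent `i, j`,
and from `A_i A_j = A_j A_i` for distant ones.

The quadratic relation is formal. For adjacent positions, a word with descent `i` has exactly one
image under `Cap j`, and `Cap i` takes it back (`Cap.exists_of_adj`, `Cap.symm_of_adj`); this makes
`E_i L_j` and `E_j L_i` inverse to each other on the relevant vertices. For distant positions one
needs that caps commute (`Cap.comm`) and preserve distant descents (`Cap.descent_of_ne`).
Commutation is evident from pictures; the proof tracks how toggling letters changes the matching
(`Matched.of_toggle`, `Matched.of_raise`), by means of height functions of the word unrolled to `ℤ`.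
-/

/-! ### Cyclic words and their parenthesis matching -/

/-- The step `±1` of a letter. -/
def letterStep (b : Bool) : ℤ := if b then 1 else -1

/-- `h` is a height function of the cyclic word `w`. -/
def IsHeight {n : ℕ} (w : ZMod n → Bool) (h : ℤ → ℤ) : Prop :=
  ∀ z : ℤ, h (z + 1) = h z + letterStep (w z)

/-- The letters at `c` and `d` form a matching pair of parentheses. -/
structure Arc (h : ℤ → ℤ) (c d : ℤ) : Prop where
  lt : c < d
  eq : h (d + 1) = h c
  above : ∀ z, c < z → z ≤ d → h c < h z

/-- The positions `c` and `d` of the cyclic word `w` are matched, where `true` opens a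
parenthesis and `false` closes it. -/
def Matched {n : ℕ} (w : ZMod n → Bool) (c d : ZMod n) : Prop :=
  ∃ h, IsHeight w h ∧ ∃ C D : ℤ, (C : ZMod n) = c ∧ (D : ZMod n) = d ∧ Arc h C D

/-- The word obtained from `w` by toggling the letters at `a` and `b`. -/
def toggle {n : ℕ} (w : ZMod n → Bool) (a b : ZMod n) : ZMod n → Bool :=
  fun z => (w z ^^ decide (z = a)) ^^ decide (z = b)

theorem exists_isHeight {n : ℕ} (w : ZMod n → Bool) : ∃ h, IsHeight w h := by
  refine ⟨fun z => ∑ k ∈ Finset.Ico 0 z, letterStep (w k) - ∑ k ∈ Finset.Ico z 0, letterStep (w k),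
    fun z => ?_⟩
  beta_reduce
  rcases le_or_gt 0 z with hz | hz
  · have e : Finset.Ico 0 (z + 1) = insert z (Finset.Ico 0 z) := by
      ext k; simp only [Finset.mem_insert, Finset.mem_Ico]; omega
    rw [e, Finset.sum_insert (by simp), Finset.Ico_eq_empty (by omega : ¬ z + 1 < 0),
      Finset.Ico_eq_empty (by omega : ¬ z < 0)]
    simp only [Finset.sum_empty]; ring
  · have e : Finset.Ico z 0 = insert z (Finset.Ico (z + 1) 0) := by
      ext k; simp only [Finset.mem_insert, Finset.mem_Ico]; omega
    rw [e, Finset.sum_insert (by simp), Finset.Ico_eq_empty (by omega : ¬ 0 < z + 1),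
      Finset.Ico_eq_empty (by omega : ¬ 0 < z)]
    simp only [Finset.sum_empty]; ring

namespace IsHeight

variable {n : ℕ} {w : ZMod n → Bool} {h h' : ℤ → ℤ}

theorem eq_add_const (hh : IsHeight w h) (hh' : IsHeight w h') (z : ℤ) :
    h' z = h z + (h' 0 - h 0) := by
  induction z with
  | zero => ring
  | succ k ih => rw [hh k, hh' k, ih]; ring
  | pred k ih =>
    have e1 := hh (-(k : ℤ) - 1)
    have e2 := hh' (-(k : ℤ) - 1)
    rw [sub_add_cancel] at e1 e2
    linarith

theorem shift (hh : IsHeight w h) (t : ℤ) : IsHeight w (fun z => h (z + t * n)) := by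
  intro z
  have := hh (z + t * n)
  simp only [Int.cast_add, Int.cast_mul, Int.cast_natCast, CharP.cast_eq_zero, mul_zero,
    add_zero] at this
  rw [← this]
  ring_nf

/-- A height need not be periodic: one turn around the circle adds the excess of `true` over
`false`. Translates still differ by constants, and arcs only compare heights, so arcs can be
translated. -/
theorem shift_eq (hh : IsHeight w h) (t z : ℤ) :
    h (z + t * n) = h z + (h (t * n) - h 0) := by
  simpa using hh.eq_add_const (hh.shift t) z

theorem succ_true (hh : IsHeight w h) {z : ℤ} (hz : w z = true) : h (z + 1) = h z + 1 := by
  rw [hh z, hz]; rfl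

theorem succ_false (hh : IsHeight w h) {z : ℤ} (hz : w z = false) : h (z + 1) = h z - 1 := by
  rw [hh z, hz]; rfl

theorem succ_cases (hh : IsHeight w h) (z : ℤ) :
    (w z = true ∧ h (z + 1) = h z + 1) ∨ (w z = false ∧ h (z + 1) = h z - 1) := by
  cases hz : w z
  · exact Or.inr ⟨rfl, hh.succ_false hz⟩
  · exact Or.inl ⟨rfl, hh.succ_true hz⟩

end IsHeight

theorem Arc.congr {h h' : ℤ → ℤ} {c d : ℤ} (ha : Arc h c d) (k s : ℤ)
    (hk : ∀ z, h' (z + s) = h z + k) : Arc h' (c + s) (d + s) where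
  lt := by have := ha.lt; omega
  eq := by
    have := ha.eq
    have e := hk (d + 1)
    rw [show d + s + 1 = d + 1 + s by ring, e, hk]
    omega
  above z h1 h2 := by
    have := ha.above (z - s) (by omega) (by omega)
    have e := hk (z - s)
    rw [sub_add_cancel] at e
    rw [hk, e]
    omega

section

variable {n : ℕ} {w : ZMod n → Bool} {h : ℤ → ℤ}

theorem Arc.shift (hh : IsHeight w h) {c d : ℤ} (ha : Arc h c d) (t : ℤ) :
    Arc h (c + t * n) (d + t * n) :=
  ha.congr _ _ (fun z => hh.shift_eq t z)

theorem exists_shift {a b : ℤ} (hab : (a : ZMod n) = b) : ∃ t : ℤ, b = a + t * n := by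
  obtain ⟨t, ht⟩ := (ZMod.intCast_eq_intCast_iff_dvd_sub _ _ _).1 hab
  exact ⟨t, by linarith⟩

theorem cast_shift (a t : ℤ) : ((a + t * n : ℤ) : ZMod n) = a := by simp

theorem Matched.of_arc (hh : IsHeight w h) {c d : ℤ} (ha : Arc h c d) :
    Matched w (c : ZMod n) d :=
  ⟨h, hh, c, d, rfl, rfl, ha⟩

/-- `Matched` hides a choice of height and of representatives; this allows both the height and the
integer lifting the left end to be prescribed. -/
theorem Matched.lift_left (hh : IsHeight w h) {c : ℤ} {d : ZMod n} (hm : Matched w (c : ZMod n) d) :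
    ∃ D : ℤ, (D : ZMod n) = d ∧ Arc h c D := by
  obtain ⟨h', hh', C, D, hC, hD, ha⟩ := hm
  obtain ⟨t, ht⟩ := exists_shift hC
  refine ⟨D + t * n, by rw [cast_shift, hD], ?_⟩
  rw [ht]
  refine Arc.shift hh ?_ t
  simpa using ha.congr _ 0 (fun z => by rw [add_zero]; exact hh'.eq_add_const hh z)

theorem Matched.lift_right (hh : IsHeight w h) {d : ℤ} {c : ZMod n}
    (hm : Matched w c (d : ZMod n)) : ∃ C : ℤ, (C : ZMod n) = c ∧ Arc h C d := by
  obtain ⟨h', hh', C, D, hC, hD, ha⟩ := hm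
  obtain ⟨t, ht⟩ := exists_shift hD
  refine ⟨C + t * n, by rw [cast_shift, hC], ?_⟩
  rw [ht]
  refine Arc.shift hh ?_ t
  simpa using ha.congr _ 0 (fun z => by rw [add_zero]; exact hh'.eq_add_const hh z)

theorem Arc.left (hh : IsHeight w h) {c d : ℤ} (ha : Arc h c d) : w c = true := by
  have h1 := ha.above (c + 1) (by omega) (by have := ha.lt; omega)
  rcases hh.succ_cases c with h2 | h2
  · exact h2.1
  · omega

theorem Arc.right (hh : IsHeight w h) {c d : ℤ} (ha : Arc h c d) : w d = false := by
  have h1 := ha.above d ha.lt le_rfl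
  have h3 := ha.eq
  rcases hh.succ_cases d with h2 | h2
  · omega
  · exact h2.1

/-- A longer arc would overlap its own translate: then `h c < h (c + n)`, while `d + 1` lies under
the translate, so that `h (c + n) < h (d + 1) = h c`. -/
theorem Arc.lt_add (hh : IsHeight w h) {c d : ℤ} (ha : Arc h c d) (hn : 0 < n) : d < c + n := by
  by_contra hc
  push Not at hc
  have h1 := ha.shift hh 1
  rw [one_mul] at h1
  have h2 := ha.above (c + n) (by omega) hc
  have h4 := ha.left hh
  have h5 := ha.right hh
  have hne : d ≠ c + n := by
    rintro rfl
    simp [h4] at h5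
  have h3 := h1.above (d + 1) (by omega) (by omega)
  have := ha.eq
  omega

/-- `d + 1` is the first return to the height `h c` after `c`. -/
theorem Arc.right_unique {c d d' : ℤ} (ha : Arc h c d) (hb : Arc h c d') : d = d' := by
  rcases lt_trichotomy d d' with h1 | h1 | h1
  · have := hb.above (d + 1) (by have := ha.lt; omega) (by omega)
    have := ha.eq
    omega
  · exact h1
  · have := ha.above (d' + 1) (by have := hb.lt; omega) (by omega)
    have := hb.eq
    omega

theorem Arc.left_unique {c c' d : ℤ} (ha : Arc h c d) (hb : Arc h c' d) : c = c' := by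
  have e1 := ha.eq
  have e2 := hb.eq
  rcases lt_trichotomy c c' with h1 | h1 | h1
  · have := ha.above c' h1 hb.lt.le
    omega
  · exact h1
  · have := hb.above c h1 ha.lt.le
    omega

variable {c c' d d' : ZMod n}

theorem Matched.left (hm : Matched w c d) : w c = true := by
  obtain ⟨h, hh, C, D, rfl, rfl, ha⟩ := hm
  exact ha.left hh

theorem Matched.right (hm : Matched w c d) : w d = false := by
  obtain ⟨h, hh, C, D, rfl, rfl, ha⟩ := hm
  exact ha.right hh

theorem Matched.right_unique (hm : Matched w c d) (hm' : Matched w c d') : d = d' := by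
  obtain ⟨h, hh, C, D, rfl, rfl, ha⟩ := hm
  obtain ⟨D', rfl, ha'⟩ := hm'.lift_left hh
  rw [ha.right_unique ha']

theorem Matched.left_unique (hm : Matched w c d) (hm' : Matched w c' d) : c = c' := by
  obtain ⟨h, hh, C, D, rfl, rfl, ha⟩ := hm
  obtain ⟨D', rfl, ha'⟩ := hm'.lift_right hh
  rw [ha'.left_unique ha]

/-- Adjacent letters `true`, `false` are matched. -/
theorem matched_succ (h1 : w c = true) (h2 : w (c + 1) = false) : Matched w c (c + 1) := by
  obtain ⟨h, hh⟩ := exists_isHeight w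
  obtain ⟨C, rfl⟩ := ZMod.intCast_surjective c
  have e1 := hh.succ_true h1
  have e2 := hh.succ_false (z := C + 1) (by simpa using h2)
  refine ⟨h, hh, C, C + 1, rfl, by simp, by omega, by omega, fun z hz hz' => ?_⟩
  obtain rfl : z = C + 1 := by omega
  omega

/-- The word strictly between two matched letters starts with `true` and ends with `false`. -/
theorem Matched.inner (hm : Matched w c d) :
    d = c + 1 ∨ (w (c + 1) = true ∧ w (d - 1) = false) := by
  obtain ⟨h, hh, C, D, rfl, rfl, ha⟩ := hm
  by_cases hD : D = C + 1
  · left; simp [hD]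
  · right
    have hlt := ha.lt
    have e0 := hh.succ_true (ha.left hh)
    have e3 := hh.succ_false (ha.right hh)
    have e4 := ha.eq
    constructor
    · have a1 := ha.above (C + 1 + 1) (by omega) (by omega)
      rcases hh.succ_cases (C + 1) with h2 | h2
      · simpa using h2.1
      · omega
    · have a1 := ha.above (D - 1) (by omega) (by omega)
      rcases hh.succ_cases (D - 1) with h2 | h2
      · rw [sub_add_cancel] at h2
        omega
      · simpa using h2.1

/-- If the letter before the right end of a matched pair closes a parenthesis, then it is matched
inside of the pair. -/
theorem Matched.exists_inner (hm : Matched w c d) (hd : w (d - 1) = false) (hn : 0 < n) :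
    ∃ m, Matched w m (d - 1) ∧ m ≠ c ∧ m ≠ c - 1 := by
  obtain ⟨h, hh, C, D, rfl, rfl, ha⟩ := hm
  have hlt := ha.lt
  have hlt' := ha.lt_add hh hn
  have e0 := hh.succ_true (ha.left hh)
  have e3 := hh.succ_false (ha.right hh)
  have e4 := ha.eq
  have e5 := hh.succ_false (z := D - 1) (by simpa using hd)
  rw [sub_add_cancel] at e5
  have hCD : C < D - 1 := by
    by_contra hc
    obtain rfl : D = C + 1 := by omega
    have := ha.left hh
    simp [this] at hd
  -- The mate of `D - 1` is the last position before `D` of height at most `h D`. The position `C +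
  -- 1` qualifies, since `h (C + 1) = h C + 1 = h D`; therefore `m ≥ C + 1`.
  obtain ⟨m, ⟨hm1, hm2⟩, hm3⟩ := Int.exists_greatest_of_bdd
    (P := fun z => z < D ∧ z ≤ D - 1 ∧ h z ≤ h D) ⟨D, fun z hz => by omega⟩
    ⟨C + 1, by omega, by omega, by omega⟩
  have hmC : C + 1 ≤ m := hm3 _ ⟨by omega, by omega, by omega⟩
  have hm4 : ∀ z, m < z → z ≤ D - 1 → h D < h z := by
    intro z h1 h2
    by_contra hc
    have := hm3 z ⟨by omega, h2, by omega⟩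
    omega
  have hmD : m < D - 1 := by
    rcases lt_or_eq_of_le hm2.1 with h1 | h1
    · exact h1
    · rw [h1] at hm2; omega
  have hmeq : h m = h D := by
    have := hm4 (m + 1) (by omega) (by omega)
    rcases hh.succ_cases m with h2 | h2 <;> omega
  refine ⟨m, ?_, ?_, ?_⟩
  · have : Arc h m (D - 1) := ⟨hmD, by rw [sub_add_cancel, hmeq], fun z h1 h2 => by
      rw [hmeq]; exact hm4 z h1 h2⟩
    simpa using Matched.of_arc hh this
  -- As `D < C + n`, the integer `m` lies strictly between `C` and `C - 1 + n`, so it is congruent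
  -- to neither `C` nor `C - 1`.
  · intro hc
    obtain ⟨t, ht⟩ := exists_shift hc
    have : -1 < t := by
      by_contra hc; push Not at hc
      nlinarith
    have : t < 1 := by
      by_contra hc; push Not at hc
      nlinarith
    obtain rfl : t = 0 := by omega
    omega
  · intro hc
    have hc' : ((C - 1 : ℤ) : ZMod n) = m := by rw [hc]; simp
    obtain ⟨t, ht⟩ := exists_shift hc'
    have : -1 < t := by
      by_contra hc; push Not at hc
      nlinarith
    have : t < 1 := by
      by_contra hc; push Not at hc
      nlinarith
    obtain rfl : t = 0 := by omega
    omega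

end

/-! ### The effect of toggling on the matching -/

section

variable {n : ℕ} {w : ZMod n → Bool} {h : ℤ → ℤ}

theorem shift_eq_zero {n : ℕ} {x y t : ℤ} (h1 : x = y + t * n) (h2 : x < y + n) (h3 : y < x + n) :
    t = 0 := by
  have a1 : -1 < t := by
    by_contra hc; push Not at hc
    nlinarith
  have a2 : t < 1 := by
    by_contra hc; push Not at hc
    nlinarith
  omega

/-- The translates of the interval `(c, d]`. -/
def UnderArc (n : ℕ) (c d z : ℤ) : Prop := ∃ t : ℤ, c < z + t * n ∧ z + t * n ≤ d

open Classical in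
/-- The height function obtained by lowering `h` under the arc from `c` to `d`. -/
noncomputable def lowered (n : ℕ) (h : ℤ → ℤ) (c d : ℤ) (z : ℤ) : ℤ :=
  h z - if UnderArc n c d z then 2 else 0

theorem lowered_of_under {c d z : ℤ} (hz : UnderArc n c d z) : lowered n h c d z = h z - 2 := by
  simp [lowered, hz]

theorem lowered_of_not_under {c d z : ℤ} (hz : ¬ UnderArc n c d z) :
    lowered n h c d z = h z := by
  simp [lowered, hz]

theorem toggle_left {a b : ZMod n} (hab : a ≠ b) : toggle w a b a = !w a := by
  simp [toggle, hab]

theorem toggle_right {a b : ZMod n} (hab : a ≠ b) : toggle w a b b = !w b := by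
  simp [toggle, hab.symm]

theorem toggle_of_ne {a b z : ZMod n} (h1 : z ≠ a) (h2 : z ≠ b) : toggle w a b z = w z := by
  simp [toggle, h1, h2]

/-- Reading from left to right, `UnderArc` switches on just after a translate of `c` and off just
after a translate of `d`, because an arc is shorter than `n` and its translates are disjoint. These
are the positions of the two toggled letters. -/
theorem isHeight_lowered (hh : IsHeight w h) {c d : ℤ} (ha : Arc h c d)
    (hn : 0 < n) : IsHeight (toggle w (c : ZMod n) d) (lowered n h c d) := by
  have hlt := ha.lt
  have hlt' := ha.lt_add hh hn
  have hl := ha.left hh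
  have hr := ha.right hh
  have hne : (c : ZMod n) ≠ d := by intro e; rw [e, hr] at hl; cases hl
  intro z
  by_cases hzc : (z : ZMod n) = c
  · obtain ⟨t, ht⟩ := exists_shift hzc
    have h1 : ¬ UnderArc n c d z := by
      rintro ⟨s, h1, h2⟩
      have := shift_eq_zero (n := n) (x := z + s * n) (y := c) (t := s - t)
        (by rw [ht]; ring) (by omega) (by omega)
      have : s = t := by omega
      subst this
      omega
    have h2 : UnderArc n c d (z + 1) := ⟨t, by omega, by omega⟩
    rw [lowered_of_not_under h1, lowered_of_under h2, hh.succ_true (by rw [hzc]; exact hl), hzc,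
      toggle_left hne, hl]
    simp [letterStep]; ring
  by_cases hzd : (z : ZMod n) = d
  · obtain ⟨t, ht⟩ := exists_shift hzd
    have h1 : ¬ UnderArc n c d (z + 1) := by
      rintro ⟨s, h1, h2⟩
      have := shift_eq_zero (n := n) (x := z + s * n) (y := d) (t := s - t)
        (by rw [ht]; ring) (by omega) (by omega)
      have : s = t := by omega
      subst this
      omega
    have h2 : UnderArc n c d z := ⟨t, by omega, by omega⟩
    rw [lowered_of_not_under h1, lowered_of_under h2, hh.succ_false (by rw [hzd]; exact hr), hzd,
      toggle_right hne, hr]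
    simp [letterStep]; ring
  have hiff : UnderArc n c d (z + 1) ↔ UnderArc n c d z := by
    constructor
    · rintro ⟨t, h1, h2⟩
      refine ⟨t, ?_, by omega⟩
      have : z + t * n ≠ c := by
        intro e; apply hzc; rw [← e]; simp
      omega
    · rintro ⟨t, h1, h2⟩
      refine ⟨t, by omega, ?_⟩
      have : z + t * n ≠ d := by
        intro e; apply hzd; rw [← e]; simp
      omega
  rw [toggle_of_ne hzc hzd]
  by_cases hz : UnderArc n c d z
  · rw [lowered_of_under hz, lowered_of_under (hiff.2 hz), hh z]; ring
  · rw [lowered_of_not_under hz, lowered_of_not_under (mt hiff.1 hz), hh z]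

variable {i k c d : ZMod n}

/-- Toggling a matched pair `(i + 1, k)` preceded by `true` keeps the pairs that do not
contain `i` or `i + 1`. -/
theorem Matched.toggle_of_ne (hn : 0 < n) (hi : w i = true) (hk : Matched w (i + 1) k)
    (hm : Matched w c d) (hc : c ≠ i) (hc' : c ≠ i + 1) :
    Matched (toggle w (i + 1) k) c d := by
  obtain ⟨h, hh, C, D, rfl, rfl, ha⟩ := hm
  obtain ⟨I, rfl⟩ := ZMod.intCast_surjective i
  have hk' : Matched w ((I + 1 : ℤ) : ZMod n) k := by simpa using hk
  obtain ⟨K, rfl, hb⟩ := hk'.lift_left hh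
  have hl := isHeight_lowered hh hb hn
  rw [Int.cast_add, Int.cast_one] at hl
  refine Matched.of_arc hl ?_
  have e0 := hh.succ_true hi
  have eK := hh.succ_false (hb.right hh)
  have eK' := hb.eq
  -- An arc that starts under the toggled one stays under it and is lowered as a whole.
  by_cases hC : UnderArc n (I + 1) K C
  · obtain ⟨t, h1, h2⟩ := hC
    have ha' := ha.shift hh t
    have hne : C + t * n ≠ K := by
      intro e
      have := hb.right hh
      rw [← e, ha'.left hh] at this
      cases this
    have hD : D + t * n < K := by
      by_contra hc
      have a1 := ha'.above K (by omega) (by omega)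
      have a2 := hb.above (C + t * n) h1 h2
      omega
    have hz : ∀ z, C ≤ z → z ≤ D + 1 → UnderArc n (I + 1) K z :=
      fun z h3 h4 => ⟨t, by omega, by omega⟩
    refine ⟨ha.lt, ?_, fun z h3 h4 => ?_⟩
    · have := ha.lt
      rw [lowered_of_under (hz _ le_rfl (by omega)), lowered_of_under (hz _ (by omega) le_rfl),
        ha.eq]
    · rw [lowered_of_under (hz _ le_rfl (by omega)),
        lowered_of_under (hz _ (by omega) (by omega))]
      have := ha.above z h3 h4
      omega
  -- An arc from outside that reaches such a point passes over `I`, since it starts at neither `I`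
  -- nor `I + 1`. The three strict rises from `C` to `I`, to `I + 1` and to `z` give the margin 3,
  -- which survives lowering by 2.
  · have key : ∀ z, C < z → z ≤ D + 1 → UnderArc n (I + 1) K z → z ≤ D ∧ h C + 3 ≤ h z := by
      rintro z h1 h2 ⟨t, h3, h4⟩
      have h5 : ¬ I + 1 < C + t * n := fun h5 => hC ⟨t, h5, by omega⟩
      have h6 : C + t * n ≠ I + 1 := by
        intro e; apply hc'
        rw [← cast_shift (n := n) C t, e]; simp
      have h7 : C + t * n ≠ I := by
        intro e; apply hc
        rw [← cast_shift (n := n) C t, e]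
      have ha' := ha.shift hh t
      have a1 := ha'.above I (by omega) (by omega)
      have a2 := hb.above (z + t * n) h3 h4
      have e1 := hh.shift_eq t z
      have e2 := hh.shift_eq t C
      refine ⟨?_, by omega⟩
      by_contra hc
      obtain rfl : z = D + 1 := by omega
      have := ha.eq
      omega
    have hD : ¬ UnderArc n (I + 1) K (D + 1) := fun hu => by
      have := key (D + 1) (by have := ha.lt; omega) le_rfl hu
      omega
    refine ⟨ha.lt, ?_, fun z h3 h4 => ?_⟩
    · rw [lowered_of_not_under hC, lowered_of_not_under hD, ha.eq]
    · rw [lowered_of_not_under hC]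
      by_cases hz : UnderArc n (I + 1) K z
      · have := key z h3 (by omega) hz
        rw [lowered_of_under hz]; omega
      · rw [lowered_of_not_under hz]; exact ha.above z h3 h4

/-- Toggling a matched pair `(i + 1, k)` inside of a matched pair `(i, d)` yields the
pair `(k, d)`. -/
theorem Matched.toggle_left (hn : 0 < n) (hk : Matched w (i + 1) k)
    (hm : Matched w i d) : Matched (toggle w (i + 1) k) k d := by
  obtain ⟨h, hh, I, D, rfl, rfl, ha⟩ := hm
  have hk' : Matched w ((I + 1 : ℤ) : ZMod n) k := by simpa using hk
  obtain ⟨K, rfl, hb⟩ := hk'.lift_left hh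
  have hl := isHeight_lowered hh hb hn
  rw [Int.cast_add, Int.cast_one] at hl
  refine Matched.of_arc hl ?_
  have e0 := hh.succ_true (ha.left hh)
  have eK := hh.succ_false (hb.right hh)
  have eK' := hb.eq
  have eD := ha.eq
  have hlt := hb.lt
  have hKD : K < D := by
    by_contra hc
    have a1 := hb.above (D + 1)
    have a2 : D ≠ I + 1 := by
      rintro rfl
      have h1 := hb.left hh
      rw [ha.right hh] at h1
      cases h1
    have a3 : D ≠ K := by rintro rfl; omega
    have := ha.lt
    have := a1 (by omega) (by omega)
    omega
  have hlt' := ha.lt_add hh hn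
  have hKu : UnderArc n (I + 1) K K := ⟨0, by simpa using hlt, by simp⟩
  have hnu : ∀ z, K < z → z ≤ D + 1 → ¬ UnderArc n (I + 1) K z := by
    rintro z h1 h2 ⟨t, h3, h4⟩
    have : t = 0 := shift_eq_zero (n := n) (x := z + t * n) (y := z) rfl (by omega) (by omega)
    subst this
    omega
  refine ⟨hKD, ?_, fun z h1 h2 => ?_⟩
  · rw [lowered_of_under hKu, lowered_of_not_under (hnu _ (by omega) le_rfl)]
    omega
  · rw [lowered_of_under hKu, lowered_of_not_under (hnu _ (by omega) (by omega))]
    have := ha.above z (by omega) h2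
    omega

/-- The pairs that are matched after toggling a matched pair `(i + 1, k)` preceded by `true`. -/
theorem Matched.of_toggle (hn : 0 < n) (hi : w i = true) (hk : Matched w (i + 1) k)
    (hm : Matched (toggle w (i + 1) k) c d) :
    (c = i ∧ d = i + 1) ∨ (c = k ∧ Matched w i d) ∨ Matched w c d := by
  have hne : i + 1 ≠ k := by
    rintro rfl
    have h1 := hk.left
    rw [hk.right] at h1
    cases h1
  have hik : i ≠ k := by
    rintro rfl
    have h1 := hk.right
    rw [hi] at h1
    cases h1
  -- Equality forces `n = 1`, where no arc exists because arcs are shorter than `n`.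
  have hii : i ≠ i + 1 := by
    intro e
    obtain ⟨h, hh⟩ := exists_isHeight w
    obtain ⟨I, rfl⟩ := ZMod.intCast_surjective i
    have hk' : Matched w ((I : ℤ) : ZMod n) k := by rw [e]; exact hk
    obtain ⟨K, hK, hb⟩ := hk'.lift_left hh
    have h3 := hb.lt_add hh hn
    have h4 := hb.lt
    have : ((I + 1 : ℤ) : ZMod n) = I := by rw [e]; simp
    obtain ⟨t, ht⟩ := exists_shift this
    have h5 : n = 1 := by
      have h6 : t * n = -1 := by omega
      have : (n : ℤ) ∣ 1 := ⟨-t, by linarith⟩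
      have := Int.le_of_dvd one_pos this
      omega
    omega
  have hpair : Matched (toggle w (i + 1) k) i (i + 1) := by
    apply matched_succ
    · rw [_root_.toggle_of_ne hii hik, hi]
    · rw [_root_.toggle_left hne, hk.left]; rfl
  by_cases hci : c = i
  · subst hci
    exact Or.inl ⟨rfl, hm.right_unique hpair⟩
  by_cases hdi : d = i + 1
  · subst hdi
    exact Or.inl ⟨hm.left_unique hpair, rfl⟩
  right
  have hci' : c ≠ i + 1 := by
    rintro rfl
    have h1 := hm.left
    rw [hpair.right] at h1
    cases h1
  obtain ⟨h, hh⟩ := exists_isHeight w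
  obtain ⟨I, rfl⟩ := ZMod.intCast_surjective i
  have hk' : Matched w ((I + 1 : ℤ) : ZMod n) k := by simpa using hk
  obtain ⟨K, rfl, hb⟩ := hk'.lift_left hh
  have hl := isHeight_lowered hh hb hn
  rw [Int.cast_add, Int.cast_one] at hl
  have e0 := hh.succ_true hi
  have e1 := hh.succ_true (hb.left hh)
  have eK := hh.succ_false (hb.right hh)
  have eK' := hb.eq
  have hlt := hb.lt
  -- After lowering, `h I` is the minimum on `(I + 1, K]`, attained at `I + 2` and at `K`. A new arc
  -- that comes from the left and passes over `I + 2` starts below `h I`, so it cannot return to its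
  -- initial height inside this interval.
  have low : ∀ z, I + 1 < z → z ≤ K → h I ≤ lowered n h (I + 1) K z := by
    intro z h1 h2
    rw [lowered_of_under ⟨0, by simpa using h1, by simpa using h2⟩]
    have := hb.above z h1 h2
    omega
  have lowK : lowered n h (I + 1) K K = h I := by
    rw [lowered_of_under ⟨0, by simpa using hlt, by simp⟩]
    omega
  have low2 : lowered n h (I + 1) K (I + 1 + 1) = h I := by
    rw [lowered_of_under ⟨0, by simp, by simpa using by omega⟩]
    omega
  have hle : ∀ z, lowered n h (I + 1) K z ≤ h z := by
    intro z
    by_cases hz : UnderArc n (I + 1) K z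
    · rw [lowered_of_under hz]; omega
    · rw [lowered_of_not_under hz]
  -- A new arc starts at `K` and then extends to an old arc from `I`, or it starts strictly inside
  -- and stays there, or it starts outside and ends outside.
  by_cases hC : ∃ C : ℤ, (C : ZMod n) = c ∧ I + 1 < C ∧ C ≤ K
  · obtain ⟨C, rfl, h1, h2⟩ := hC
    obtain ⟨D, rfl, ha⟩ := hm.lift_left hl
    have hCu : UnderArc n (I + 1) K C := ⟨0, by simpa using h1, by simpa using h2⟩
    by_cases hCK : C = K
    · left
      subst hCK
      refine ⟨rfl, ?_⟩
      have haeq := ha.eq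
      have hDu : ¬ UnderArc n (I + 1) C (D + 1) := by
        rintro ⟨t, h3, h4⟩
        have h5 : D + t * n ≠ I + 1 := by
          intro e; apply hdi
          rw [← cast_shift (n := n) D t, e]; simp
        have ha' := ha.shift hl t
        have h6 := low (D + 1 + t * n) h3 h4
        have h7 := hl.shift_eq t (D + 1)
        have h8 := hl.shift_eq t C
        have h9 := ha.lt
        by_cases h10 : C + t * n < I + 1 + 1
        · have := ha'.above (I + 1 + 1) h10 (by omega)
          omega
        · have := hb.lt_add hh hn
          rcases lt_trichotomy t 0 with h | h | h
          · nlinarith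
          · subst h; omega
          · nlinarith
      rw [lowK, lowered_of_not_under hDu] at haeq
      refine Matched.of_arc hh ⟨by have := ha.lt; omega, haeq, fun z h3 h4 => ?_⟩
      by_cases h5 : z ≤ C
      · by_cases h6 : z = I + 1
        · subst h6; omega
        · have := hb.above z (by omega) h5
          omega
      · have := ha.above z (by omega) h4
        have := hle z
        omega
    · right
      have hDK : D < K := by
        by_contra hc
        have := ha.above K (by omega) (by omega)
        have := low C h1 h2
        omega
      have hz : ∀ z, C ≤ z → z ≤ D + 1 → UnderArc n (I + 1) K z :=
        fun z h3 h4 => ⟨0, by simpa using by omega, by simpa using by omega⟩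
      refine Matched.of_arc hh ⟨ha.lt, ?_, fun z h3 h4 => ?_⟩
      · have h4 := ha.eq
        have := ha.lt
        rw [lowered_of_under (hz _ le_rfl (by omega)),
          lowered_of_under (hz _ (by omega) le_rfl)] at h4
        omega
      · have h5 := ha.above z h3 h4
        rw [lowered_of_under (hz _ le_rfl (by omega)),
          lowered_of_under (hz _ (by omega) (by omega))] at h5
        omega
  · right
    obtain ⟨C, rfl⟩ := ZMod.intCast_surjective c
    obtain ⟨D, rfl, ha⟩ := hm.lift_left hl
    have hCu : ¬ UnderArc n (I + 1) K C := by
      rintro ⟨t, h1, h2⟩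
      exact hC ⟨C + t * n, cast_shift _ _, h1, h2⟩
    have haeq := ha.eq
    have hDu : ¬ UnderArc n (I + 1) K (D + 1) := by
      rintro ⟨t, h3, h4⟩
      have h5 : D + t * n ≠ I + 1 := by
        intro e; apply hdi
        rw [← cast_shift (n := n) D t, e]; simp
      have h0 : ¬ I + 1 < C + t * n := by
        intro h0
        exact hCu ⟨t, h0, by have := ha.lt; omega⟩
      have ha' := ha.shift hl t
      have h6 := low (D + 1 + t * n) h3 h4
      have h7 := hl.shift_eq t (D + 1)
      have h8 := hl.shift_eq t C
      have := ha'.above (I + 1 + 1) (by omega) (by omega)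
      omega
    rw [lowered_of_not_under hCu, lowered_of_not_under hDu] at haeq
    refine Matched.of_arc hh ⟨ha.lt, haeq, fun z h3 h4 => ?_⟩
    have h5 := ha.above z h3 h4
    have := hle z
    rw [lowered_of_not_under hCu] at h5
    omega

end

/-! ### Toggling a valley, mirror symmetry and caps -/

section

variable {n : ℕ} {w : ZMod n → Bool} {h : ℤ → ℤ}

/-- The height function obtained by raising `h` at the translates of `i + 1`. -/
def raised {n : ℕ} (h : ℤ → ℤ) (i : ZMod n) (z : ℤ) : ℤ :=
  h z + if (z : ZMod n) = i + 1 then 2 else 0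

theorem ne_succ_of_valley {i : ZMod n} (h1 : w i = false) (h2 : w (i + 1) = true) : i ≠ i + 1 := by
  intro e
  rw [← e, h1] at h2
  cases h2

theorem isHeight_raised (hh : IsHeight w h) {i : ZMod n} (h1 : w i = false)
    (h2 : w (i + 1) = true) : IsHeight (toggle w i (i + 1)) (raised h i) := by
  have hne := ne_succ_of_valley h1 h2
  intro z
  simp only [raised, Int.cast_add, Int.cast_one, add_left_inj]
  rw [hh z]
  by_cases hz : (z : ZMod n) = i
  · simp [hz, hne, toggle_left hne, h1, letterStep]; ring
  · by_cases hz' : (z : ZMod n) = i + 1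
    · simp [hz', hne.symm, toggle_right hne, h2, letterStep]; ring
    · simp [hz, hz', toggle_of_ne hz hz']

variable {i c d : ZMod n}

/-- Raising a valley at `i`, `i + 1` keeps the pairs that do not contain `i` or `i + 1`. -/
theorem Matched.raise_of_ne (h1 : w i = false) (h2 : w (i + 1) = true) (hm : Matched w c d)
    (hc : c ≠ i + 1) (hd : d ≠ i) : Matched (toggle w i (i + 1)) c d := by
  obtain ⟨h, hh, C, D, rfl, rfl, ha⟩ := hm
  refine Matched.of_arc (isHeight_raised hh h1 h2) ⟨ha.lt, ?_, fun z h3 h4 => ?_⟩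
  · simp [raised, hc, hd, ha.eq]
  · have := ha.above z h3 h4
    simp only [raised, hc, if_false]
    split_ifs <;> omega

/-- Raising a valley at `i`, `i + 1` joins the pairs that end and start there. -/
theorem Matched.raise_join (h1 : w i = false) (h2 : w (i + 1) = true) (hm : Matched w c i)
    (hm' : Matched w (i + 1) d) (hc : c ≠ i + 1) (hd : d ≠ i) :
    Matched (toggle w i (i + 1)) c d := by
  obtain ⟨h, hh, C, I, rfl, rfl, ha⟩ := hm
  have hm'' : Matched w ((I + 1 : ℤ) : ZMod n) d := by simpa using hm'
  obtain ⟨D, rfl, hb⟩ := hm''.lift_left hh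
  have e1 := ha.eq
  have e2 := hb.eq
  have l1 := ha.lt
  have l2 := hb.lt
  refine Matched.of_arc (isHeight_raised hh h1 h2) ⟨by omega, ?_, fun z h3 h4 => ?_⟩
  · simp [raised, hc, hd]
    omega
  · simp only [raised, hc, if_false]
    rcases lt_trichotomy z (I + 1) with h5 | h5 | h5
    · have := ha.above z h3 (by omega)
      split_ifs <;> omega
    · subst h5
      simp
      omega
    · have := hb.above z h5 h4
      split_ifs <;> omega

/-- The pairs that are matched after raising a valley at `i`, `i + 1`. -/
theorem Matched.of_raise (hn : 0 < n) (h1 : w i = false) (h2 : w (i + 1) = true)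
    (hm : Matched (toggle w i (i + 1)) c d) :
    (c = i ∧ d = i + 1) ∨ Matched w c d ∨ (Matched w c i ∧ Matched w (i + 1) d) := by
  have hne := ne_succ_of_valley h1 h2
  have hpair : Matched (toggle w i (i + 1)) i (i + 1) := by
    apply matched_succ
    · rw [_root_.toggle_left hne, h1]; rfl
    · rw [_root_.toggle_right hne, h2]; rfl
  by_cases hci : c = i
  · subst hci
    exact Or.inl ⟨rfl, hm.right_unique hpair⟩
  right
  have hci' : c ≠ i + 1 := by
    rintro rfl
    have h1 := hm.left
    rw [hpair.right] at h1
    cases h1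
  have hdi : d ≠ i := by
    rintro rfl
    have h1 := hm.right
    rw [hpair.left] at h1
    cases h1
  obtain ⟨h, hh⟩ := exists_isHeight w
  have hr := isHeight_raised hh h1 h2
  obtain ⟨C, rfl⟩ := ZMod.intCast_surjective c
  obtain ⟨D, rfl, ha⟩ := hm.lift_left hr
  have e := ha.eq
  have hlen := ha.lt_add hr hn
  have hC : raised h i C = h C := by simp [raised, hci']
  have hD : raised h i (D + 1) = h (D + 1) := by simp [raised, hdi]
  rw [hC, hD] at e
  -- The interval can fail to be an arc for `h` only at a raised point `Z`, a translate of `i + 1`.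
  -- There the old height comes down exactly to `h C`, which splits the interval into two old arcs.
  by_cases hz : ∃ z, C < z ∧ z ≤ D ∧ h z ≤ h C
  · right
    obtain ⟨Z, hz1, hz2, hz3⟩ := hz
    have hZ := ha.above Z hz1 hz2
    have hZi : (Z : ZMod n) = i + 1 := by
      by_contra hc
      simp only [raised, hc, hci', if_false] at hZ
      omega
    have hZ' : h Z < h (Z - 1) := by
      have hw : w ((Z - 1 : ℤ) : ZMod n) = false := by
        rw [Int.cast_sub, hZi]; simpa using h1
      have := hh.succ_false hw
      rw [sub_add_cancel] at this
      omega
    have hCZ : C < Z - 1 := by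
      rcases lt_or_eq_of_le (show C ≤ Z - 1 by omega) with h5 | h5
      · exact h5
      · exfalso; apply hci
        rw [h5, Int.cast_sub, hZi]; simp
    have hother : ∀ z, C < z → z ≤ D → z ≠ Z → h C < h z := by
      intro z h3 h4 h5
      have h6 := ha.above z h3 h4
      have h7 : (z : ZMod n) ≠ i + 1 := by
        intro e
        obtain ⟨t, ht⟩ := exists_shift (e.trans hZi.symm)
        have := shift_eq_zero ht (by omega) (by omega)
        subst this
        omega
      simp only [raised, h7, hci', if_false] at h6
      omega
    have hZe : h Z = h C := by
      have h5 := hother (Z - 1) hCZ (by omega) (by omega)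
      have hw : w ((Z - 1 : ℤ) : ZMod n) = false := by
        rw [Int.cast_sub, hZi]; simpa using h1
      have := hh.succ_false hw
      rw [sub_add_cancel] at this
      omega
    have hZD : Z < D := by
      rcases lt_or_eq_of_le hz2 with h5 | h5
      · exact h5
      · exfalso
        have := hh.succ_true (z := Z) (by rw [hZi]; exact h2)
        rw [h5] at this hZe
        omega
    constructor
    · have : Arc h C (Z - 1) := ⟨hCZ, by rw [sub_add_cancel, hZe],
        fun z h3 h4 => hother z h3 (by omega) (by omega)⟩
      have := Matched.of_arc hh this
      rwa [Int.cast_sub, hZi, Int.cast_one, add_sub_cancel_right] at this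
    · have : Arc h Z D := ⟨hZD, by rw [e, hZe],
        fun z h3 h4 => by rw [hZe]; exact hother z (by omega) h4 (by omega)⟩
      have := Matched.of_arc hh this
      rwa [hZi] at this
  · left
    push Not at hz
    exact Matched.of_arc hh ⟨ha.lt, e, hz⟩

/-! ### Mirror images -/

/-- The mirror image of a cyclic word, read as a word in parentheses. -/
def mirror (w : ZMod n → Bool) : ZMod n → Bool := fun z => !w (-z)

theorem mirror_mirror (w : ZMod n → Bool) : mirror (mirror w) = w := by
  funext z; simp [mirror]

theorem mirror_toggle (w : ZMod n → Bool) (a b : ZMod n) :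
    mirror (toggle w a b) = toggle (mirror w) (-b) (-a) := by
  funext z
  simp only [mirror, toggle, neg_eq_iff_eq_neg]
  cases w (-z) <;> cases decide (z = -a) <;> cases decide (z = -b) <;> rfl

theorem Matched.mirror (hm : Matched w c d) : Matched (mirror w) (-d) (-c) := by
  obtain ⟨h, hh, C, D, rfl, rfl, ha⟩ := hm
  -- The letter at `z` is the step from `z` to `z + 1`; reflecting it onto the step from `-z` to `-z
  -- + 1` sends the point `z` to `1 - z`.
  refine ⟨fun z => h (1 - z), fun z => ?_, -D, -C, by simp, by simp, ?_, ?_, ?_⟩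
  · have := hh (-z)
    beta_reduce
    rw [show 1 - (z + 1) = -z by ring, show 1 - z = -z + 1 by ring, this]
    simp only [_root_.mirror, Int.cast_neg]
    cases w (-(z : ZMod n)) <;> simp [letterStep]
  · have := ha.lt; omega
  · have := ha.eq
    simp only [show 1 - (-C + 1) = C by ring, show 1 - -D = D + 1 by ring, this]
  · intro z h1 h2
    have e := ha.eq
    have := ha.above (1 - z) (by omega) (by omega)
    rw [show 1 - -D = D + 1 by ring]
    omega

variable {a : ZMod n}

theorem Matched.toggle_of_ne_right (hn : 0 < n) (hi : w (i + 1) = false) (ha : Matched w a i)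
    (hm : Matched w c d) (hd : d ≠ i) (hd' : d ≠ i + 1) :
    Matched (toggle w a i) c d := by
  have h1 := Matched.toggle_of_ne (w := _root_.mirror w) (i := -(i + 1)) (k := -a) (c := -d)
    (d := -c) hn (by simp [_root_.mirror] at hi ⊢; exact hi) (by simpa using ha.mirror) hm.mirror
    (neg_injective.ne hd') (by simpa using hd)
  have h2 := h1.mirror
  rw [mirror_toggle, mirror_mirror] at h2
  simpa using h2

theorem Matched.toggle_right (hn : 0 < n) (ha : Matched w a i)
    (hm : Matched w c (i + 1)) : Matched (toggle w a i) c a := by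
  have h1 := Matched.toggle_left (w := _root_.mirror w) (i := -(i + 1)) (k := -a)
    (d := -c) hn (by simpa using ha.mirror) hm.mirror
  have h2 := h1.mirror
  rw [mirror_toggle, mirror_mirror] at h2
  simpa using h2

/-! ### The diagrammatic action on words -/

/-- `Cap i v u` means that attaching a cap at `i`, `i + 1` to the matching of `v` yields the
matching of `u`. -/
inductive Cap (i : ZMod n) (v : ZMod n → Bool) : (ZMod n → Bool) → Prop
  | valley : v i = false → v (i + 1) = true → Cap i v (toggle v i (i + 1))
  | up (k : ZMod n) : v i = true → Matched v (i + 1) k → Cap i v (toggle v (i + 1) k)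
  | down (k : ZMod n) : v (i + 1) = false → Matched v k i → Cap i v (toggle v k i)

variable {v x u : ZMod n → Bool} {j k : ZMod n}

theorem Cap.mirror (hc : Cap i v u) : Cap (-(i + 1)) (mirror v) (mirror u) := by
  cases hc with
  | valley h1 h2 =>
    have := Cap.valley (i := -(i + 1)) (v := _root_.mirror v) (by simp [_root_.mirror] at h2 ⊢; exact h2)
      (by simp [_root_.mirror, h1])
    rw [mirror_toggle]
    simpa using this
  | up k h1 h2 =>
    have := Cap.down (i := -(i + 1)) (v := _root_.mirror v) (-k) (by simp [_root_.mirror, h1])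
      h2.mirror
    rwa [mirror_toggle]
  | down k h1 h2 =>
    have := Cap.up (i := -(i + 1)) (v := _root_.mirror v) (-k)
      (by simp [_root_.mirror] at h1 ⊢; exact h1) (by simpa using h2.mirror)
    rw [mirror_toggle]
    simpa using this

theorem Cap.of_mirror (hc : Cap (-(i + 1)) (_root_.mirror v) u) : Cap i v (_root_.mirror u) := by
  have := hc.mirror
  rw [mirror_mirror] at this
  simpa using this

/-- The letters at `i` and `i + 1` decide which constructor applies, and mates are unique. So each
column of the matrix of `Cap i` has at most one non-zero entry. -/
theorem Cap.unique {u' : ZMod n → Bool} (h1 : Cap i v u) (h2 : Cap i v u') : u = u' := by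
  cases h1 with
  | valley a1 a2 =>
    cases h2 with
    | valley b1 b2 => rfl
    | up k b1 b2 => rw [a1] at b1; cases b1
    | down k b1 b2 => rw [a2] at b1; cases b1
  | up k a1 a2 =>
    cases h2 with
    | valley b1 b2 => rw [a1] at b1; cases b1
    | up k' b1 b2 => rw [a2.right_unique b2]
    | down k b1 b2 => rw [a2.left] at b1; cases b1
  | down k a1 a2 =>
    cases h2 with
    | valley b1 b2 => rw [a1] at b2; cases b2
    | up k' b1 b2 => rw [b2.left] at a1; cases a1
    | down k b1 b2 => rw [a2.left_unique b2]

theorem toggle_comm (w : ZMod n → Bool) (a b : ZMod n) : toggle w a b = toggle w b a := by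
  funext z; simp only [toggle, Bool.xor_right_comm]

theorem toggle_toggle_comm (w : ZMod n → Bool) (a b c d : ZMod n) :
    toggle (toggle w a b) c d = toggle (toggle w c d) a b := by
  funext z
  simp only [toggle]
  cases w z <;> cases decide (z = a) <;> cases decide (z = b) <;> cases decide (z = c) <;>
    cases decide (z = d) <;> rfl

theorem toggle_toggle_cancel (w : ZMod n → Bool) (a b c : ZMod n) :
    toggle (toggle w a b) b c = toggle w a c := by
  funext z; simp [toggle]

end

/-! ### Commutation of distant caps, and descents -/

section

variable {n : ℕ} {v x u : ZMod n → Bool} {i j k : ZMod n}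

theorem Matched.ne {c d : ZMod n} (hm : Matched v c d) : c ≠ d := by
  rintro rfl
  have h1 := hm.left
  rw [hm.right] at h1
  cases h1

theorem ne_of_letters {c d : ZMod n} (h1 : v c = true) (h2 : v d = false) : c ≠ d := by
  rintro rfl
  rw [h1] at h2
  cases h2

/-- The caps at distant positions commute, when the first one is attached to a valley and the
second one to an ascent. -/
theorem Cap.comm_valley_up (hn : 0 < n) (hij' : i + 1 ≠ j) (hji : j + 1 ≠ i)
    (hij : i ≠ j) (h1 : v i = false) (h2 : v (i + 1) = true)
    (h3 : toggle v i (i + 1) j = true)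
    (h4 : Matched (toggle v i (i + 1)) (j + 1) k) :
    ∃ y, Cap j v y ∧ Cap i y (toggle (toggle v i (i + 1)) (j + 1) k) := by
  have hne := ne_succ_of_valley h1 h2
  have hij1 : i + 1 ≠ j + 1 := fun e => hij (add_right_cancel e)
  rw [toggle_of_ne hij.symm hij'.symm] at h3
  have hpair : Matched (toggle v i (i + 1)) i (i + 1) := by
    apply matched_succ
    · rw [toggle_left hne, h1]; rfl
    · rw [toggle_right hne, h2]; rfl
  rcases h4.of_raise hn h1 h2 with h5 | h5 | h5
  · exact absurd h5.1 hji
  · have hki : k ≠ i := (ne_of_letters hpair.left h4.right).symm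
    have hki' : k ≠ i + 1 := by
      rintro rfl
      exact hji (h4.left_unique hpair)
    refine ⟨_, Cap.up k h3 h5, ?_⟩
    rw [toggle_toggle_comm]
    apply Cap.valley
    · rw [toggle_of_ne hji.symm hki.symm, h1]
    · rw [toggle_of_ne hij1 hki'.symm, h2]
  -- The pair `(j + 1, k)` was created by the cap at `i` from the pairs `(j + 1, i)` and `(i + 1,
  -- k)` of `v`. Capping at `j` first therefore flips `i`, and `i, i + 1` then reads `((`.
  · refine ⟨_, Cap.up i h3 h5.1, ?_⟩
    have e : toggle (toggle v i (i + 1)) (j + 1) k = toggle (toggle v (j + 1) i) (i + 1) k := by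
      funext z
      simp only [toggle]
      cases v z <;> cases decide (z = i) <;> cases decide (z = i + 1) <;>
        cases decide (z = j + 1) <;> cases decide (z = k) <;> rfl
    rw [e]
    apply Cap.up
    · rw [toggle_right h5.1.ne, h1]; rfl
    · exact Matched.toggle_of_ne hn h3 h5.1 h5.2 hij' hij1

/-- The caps at distant positions commute, when the first one is attached to an ascent. -/
theorem Cap.comm_up (hn : 0 < n) (hij' : i + 1 ≠ j) (hji : j + 1 ≠ i) (hij : i ≠ j)
    (h1 : v i = true) (h2 : Matched v (i + 1) k) (hc : Cap j (toggle v (i + 1) k) u) :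
    ∃ y, Cap j v y ∧ Cap i y u := by
  have hij1 : i + 1 ≠ j + 1 := fun e => hij (add_right_cancel e)
  have hik : i ≠ k := ne_of_letters h1 h2.right
  have hxk : toggle v (i + 1) k k = true := by rw [toggle_right h2.ne, h2.right]; rfl
  cases hc with
  | valley h3 h4 =>
    have hjk : j ≠ k := (ne_of_letters hxk h3).symm
    rw [toggle_of_ne hij'.symm hjk] at h3
    -- If `j + 1` is the mate of `i + 1`, then `v` reads `))` at `j, j + 1`, and capping at `j`
    -- first flips the mate `m` of `j`, which lies inside the pair `(i + 1, k)`.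
    by_cases hk : j + 1 = k
    · subst hk
      obtain ⟨m, hm, hm1, hm2⟩ := h2.exists_inner (by simpa using h3) hn
      simp only [add_sub_cancel_right] at hm hm2
      refine ⟨_, Cap.down m h2.right hm, ?_⟩
      have e : toggle (toggle v (i + 1) (j + 1)) j (j + 1) = toggle (toggle v m j) (i + 1) m := by
        rw [toggle_comm _ j, toggle_toggle_cancel, toggle_comm v m, toggle_comm _ (i + 1) m,
          toggle_toggle_cancel, toggle_comm]
      rw [e]
      apply Cap.up
      · rw [toggle_of_ne hm2.symm hij, h1]
      · exact hm.toggle_right hn h2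
    · rw [toggle_of_ne hij1.symm hk] at h4
      refine ⟨_, Cap.valley h3 h4, ?_⟩
      rw [toggle_toggle_comm]
      apply Cap.up
      · rw [toggle_of_ne hij hji.symm, h1]
      · exact h2.raise_of_ne h3 h4 hij1 hjk.symm
  | up l h3 h4 =>
    rcases Matched.of_toggle hn h1 h2 h4 with h5 | h5 | h5
    · exact absurd h5.1 hji
    -- Impossible: `v` would read `()` at `j, j + 1`, so the mate of `k = j + 1` would be `j`
    -- instead of `i + 1`. The equality `j = j + 1` is excluded since it makes all residues equal.
    · obtain ⟨rfl, h5⟩ := h5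
      have hjj : j ≠ j + 1 := by
        intro e
        have := h2.inner
        have e' : (1 : ZMod n) = 0 := by simpa using e
        simp only [e', add_zero] at hij1 h2 this
        exact hik (by
          have h7 : ∀ a : ZMod n, a = 0 := fun a => by rw [← mul_one a, e', mul_zero]
          rw [h7 i, h7 (j + 1)])
      rw [toggle_of_ne hij'.symm hjj] at h3
      exact absurd (h2.left_unique (matched_succ h3 h2.right)) hij'
    -- If `j` is the mate of `i + 1`, then `v` has a valley at `j`; capping there first joins `(i +
    -- 1, j)` and `(j + 1, l)` into `(i + 1, l)`.
    · by_cases hjk : j = k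
      · subst hjk
        refine ⟨_, Cap.valley h2.right h5.left, ?_⟩
        have e : toggle (toggle v (i + 1) j) (j + 1) l = toggle (toggle v j (j + 1)) (i + 1) l := by
          funext z
          simp only [toggle]
          cases v z <;> cases decide (z = j) <;> cases decide (z = i + 1) <;>
            cases decide (z = j + 1) <;> cases decide (z = l) <;> rfl
        rw [e]
        apply Cap.up
        · rw [toggle_of_ne hij hji.symm, h1]
        · refine h2.raise_join h2.right h5.left h5 hij1 ?_
          rintro rfl
          exact hij1 (h2.left_unique h5)
      · rw [toggle_of_ne hij'.symm hjk] at h3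
        refine ⟨_, Cap.up l h3 h5, ?_⟩
        rw [toggle_toggle_comm]
        apply Cap.up
        · rw [toggle_of_ne hji.symm (ne_of_letters h1 h5.right), h1]
        · exact Matched.toggle_of_ne hn h3 h5 h2 hij' hij1
  | down l h3 h4 =>
    have hkj : k ≠ j + 1 := ne_of_letters hxk h3
    have hkj' : k ≠ j := ne_of_letters hxk h4.right
    rw [toggle_of_ne hij1.symm hkj.symm] at h3
    rcases Matched.of_toggle hn h1 h2 h4 with h5 | h5 | h5
    · exact absurd h5.2.symm hij'
    -- Here `j` is the mate of `i` in `v`, so capping at `j` first flips `i` and creates a valley at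
    -- `i`.
    · obtain ⟨rfl, h5⟩ := h5
      refine ⟨_, Cap.down i h3 h5, ?_⟩
      have e : toggle (toggle v (i + 1) l) l j = toggle (toggle v i j) i (i + 1) := by
        rw [toggle_toggle_cancel, toggle_comm v i j, toggle_toggle_cancel, toggle_comm]
      have hii : i ≠ i + 1 := by
        intro e
        rw [← e] at h2
        exact hkj' (h2.right_unique h5)
      rw [e]
      apply Cap.valley
      · rw [toggle_left h5.ne, h1]; rfl
      · rw [toggle_of_ne hii.symm hij', h2.left]
    · have hli : l ≠ i := by
        rintro rfl
        exact hik (h4.left_unique (h2.toggle_left hn h5))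
      refine ⟨_, Cap.down l h3 h5, ?_⟩
      rw [toggle_toggle_comm]
      apply Cap.up
      · rw [toggle_of_ne hli.symm hij, h1]
      · exact Matched.toggle_of_ne_right hn h3 h5 h2 hkj' hkj

/-- The caps at distant positions commute. -/
theorem Cap.comm (hn : 0 < n) (hij' : i + 1 ≠ j) (hji : j + 1 ≠ i) (hij : i ≠ j)
    (hi : Cap i v x) (hj : Cap j x u) : ∃ y, Cap j v y ∧ Cap i y u := by
  have m1 : -(i + 1) + 1 ≠ -(j + 1) := fun e => hji (by linear_combination e)
  have m2 : -(j + 1) + 1 ≠ -(i + 1) := fun e => hij' (by linear_combination e)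
  have m3 : -(i + 1) ≠ -(j + 1) := fun e => hij (by linear_combination -e)
  -- The mirror interchanges the cases `up` and `down` and moves the cap at `i` to `-(i + 1)`, so
  -- half of the cases suffice.
  have back : ∀ y, Cap (-(j + 1)) (_root_.mirror v) y → Cap (-(i + 1)) y (_root_.mirror u) →
      ∃ y, Cap j v y ∧ Cap i y u := by
    intro y h1 h2
    refine ⟨_, h1.of_mirror, ?_⟩
    rw [← mirror_mirror y] at h2
    have := h2.of_mirror
    rwa [mirror_mirror] at this
  cases hi with
  | up k h1 h2 => exact Cap.comm_up hn hij' hji hij h1 h2 hj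
  | down k h1 h2 =>
    have hj' := hj.mirror
    rw [mirror_toggle] at hj'
    have h3 := h2.mirror
    obtain ⟨y, hy1, hy2⟩ := Cap.comm_up (v := _root_.mirror v) (i := -(i + 1)) (j := -(j + 1))
      (k := -k) hn m1 m2 m3 (by simp [_root_.mirror] at h1 ⊢; exact h1) (by simpa using h3)
      (by simpa using hj')
    exact back y hy1 hy2
  | valley h1 h2 =>
    have hne := ne_succ_of_valley h1 h2
    have hij1 : i + 1 ≠ j + 1 := fun e => hij (add_right_cancel e)
    cases hj with
    | valley h3 h4 =>
      rw [toggle_of_ne hij.symm hij'.symm] at h3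
      rw [toggle_of_ne hji hij1.symm] at h4
      refine ⟨_, Cap.valley h3 h4, ?_⟩
      rw [toggle_toggle_comm]
      apply Cap.valley
      · rw [toggle_of_ne hij hji.symm, h1]
      · rw [toggle_of_ne hij' hij1, h2]
    | up k h3 h4 => exact Cap.comm_valley_up hn hij' hji hij h1 h2 h3 h4
    | down k h3 h4 =>
      have h5 := h4.mirror
      have e : _root_.mirror (toggle v i (i + 1)) =
          toggle (_root_.mirror v) (-(i + 1)) (-(i + 1) + 1) := by
        rw [mirror_toggle]; simp
      have h6 : _root_.mirror (toggle v i (i + 1)) (-(j + 1)) = true := by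
        rw [_root_.mirror, neg_neg, h3]; rfl
      rw [e] at h5 h6
      obtain ⟨y, hy1, hy2⟩ := Cap.comm_valley_up (v := _root_.mirror v) (i := -(i + 1))
        (j := -(j + 1)) (k := -k) hn m1 m2 m3 (by rw [_root_.mirror, neg_neg, h2]; rfl)
        (by simp [_root_.mirror, h1]) h6 (by simpa using h5)
      refine back y hy1 ?_
      rw [mirror_toggle, e]
      simpa using hy2

/-- Attaching a cap creates a descent at its position. -/
theorem Cap.descent (hi : i ≠ i + 1) (hc : Cap i v u) : u i = true ∧ u (i + 1) = false := by
  cases hc with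
  | valley h1 h2 => rw [toggle_left hi, toggle_right hi, h1, h2]; simp
  | up k h1 h2 =>
    rw [toggle_left h2.ne, toggle_of_ne hi (ne_of_letters h1 h2.right), h1, h2.left]; simp
  | down k h1 h2 =>
    rw [toggle_right h2.ne, toggle_of_ne (ne_of_letters h2.left h1).symm hi.symm, h1, h2.right]
    simp

theorem Cap.not_descent (hc : Cap i v u) : ¬(v i = true ∧ v (i + 1) = false) := by
  rintro ⟨h1, h2⟩
  cases hc with
  | valley h3 h4 => rw [h1] at h3; cases h3
  | up k h3 h4 => rw [h4.left] at h2; cases h2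
  | down k h3 h4 => rw [h4.right] at h1; cases h1

/-- Attaching a cap keeps the descents at distant positions. -/
theorem Cap.descent_of_ne (hij' : i + 1 ≠ j) (hji : j + 1 ≠ i)
    (hc : Cap i v u) (h1 : v j = true) (h2 : v (j + 1) = false) :
    u j = true ∧ u (j + 1) = false := by
  have hm := matched_succ h1 h2
  have hij : i ≠ j := by
    rintro rfl
    exact hc.not_descent ⟨h1, h2⟩
  have hij1 : i + 1 ≠ j + 1 := fun e => hij (add_right_cancel e)
  cases hc with
  | valley h3 h4 =>
    rw [toggle_of_ne hij.symm hij'.symm, toggle_of_ne hji hij1.symm]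
    exact ⟨h1, h2⟩
  | up k h3 h4 =>
    rw [toggle_of_ne hij'.symm (ne_of_letters h1 h4.right), toggle_of_ne hij1.symm]
    · exact ⟨h1, h2⟩
    · rintro rfl
      exact hij' (h4.left_unique hm)
  | down k h3 h4 =>
    rw [toggle_of_ne (ne_of_letters h4.left h2).symm hji, toggle_of_ne _ hij.symm]
    · exact ⟨h1, h2⟩
    · rintro rfl
      exact hji (hm.right_unique h4)

end

/-! ### Counting letters in cyclic intervals -/

section

variable {n : ℕ} {w : ZMod n → Bool} {h : ℤ → ℤ}

theorem IsHeight.parity (hh : IsHeight w h) (z : ℤ) : h z % 2 = (h 0 + z) % 2 := by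
  induction z with
  | zero => simp
  | succ k ih => rcases hh.succ_cases k with h2 | h2 <;> omega
  | pred k ih =>
    have := hh.succ_cases (-(k : ℤ) - 1)
    rw [sub_add_cancel] at this
    rcases this with h2 | h2 <;> omega

theorem cast_rep [NeZero n] (x : ZMod n) : ((rep x : ℕ) : ZMod n) = x := by
  unfold rep
  split_ifs with hx
  · simp [hx]
  · simp

theorem rep_pos [NeZero n] (x : ZMod n) : 0 < rep x := by
  unfold rep
  split_ifs with hx
  · exact Nat.pos_of_ne_zero (NeZero.ne n)
  · exact Nat.pos_of_ne_zero (by simpa using hx)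

theorem rep_lt [NeZero n] {x : ZMod n} (hx : x ≠ 0) : rep x < n := by
  simp [rep, hx, ZMod.val_lt]

theorem rep_eq [NeZero n] {m : ℕ} (h0 : 0 < m) (hm : m < n) : rep (m : ZMod n) = m := by
  have hv : (m : ZMod n).val = m := ZMod.val_cast_of_lt hm
  have : (m : ZMod n) ≠ 0 := by
    intro e
    rw [e, ZMod.val_zero] at hv
    omega
  simp [rep, this, hv]

theorem rep_injective [NeZero n] : Function.Injective (rep : ZMod n → ℕ) := by
  intro x y hxy
  rw [← cast_rep x, hxy, cast_rep]

theorem int_shift_injOn [NeZero n] (X : ℤ) {m : ℕ} (hm : m ≤ n) :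
    Set.InjOn (fun t : ℕ => ((X + t : ℤ) : ZMod n)) (Finset.range m) := by
  intro s hs t ht hst
  simp only [Finset.coe_range, Set.mem_Iio] at hs ht
  simp only [Int.cast_add, Int.cast_natCast, add_right_inj] at hst
  have := congrArg ZMod.val hst
  rwa [ZMod.val_cast_of_lt (by omega), ZMod.val_cast_of_lt (by omega)] at this

/-- For `m = 0` the convention on empty intervals gives the right value. For `m = n` it would give
the empty set in place of the whole circle, hence the strict bound. -/
theorem cycInterval_eq_image [NeZero n] (X : ℤ) {m : ℕ} (hm : m < n) :
    cycInterval (X : ZMod n) ((X + m - 1 : ℤ) : ZMod n) =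
      ((Finset.range m).image fun t : ℕ => ((X + t : ℤ) : ZMod n)) := by
  ext z
  simp only [cycInterval, Set.mem_ofPred_eq, Finset.coe_image, Finset.coe_range, Set.mem_image,
    Set.mem_Iio]
  rcases Nat.eq_zero_or_pos m with rfl | h0
  · simp
  have e1 : ((X + m - 1 : ℤ) : ZMod n) - X = ((m - 1 : ℕ) : ZMod n) := by
    rw [Nat.cast_sub h0]; push_cast; ring
  have e2 : (X : ZMod n) ≠ ((X + m - 1 : ℤ) : ZMod n) + 1 := by
    intro e
    have : (m : ZMod n) = 0 := by push_cast at e; linear_combination -e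
    have := congrArg ZMod.val this
    rw [ZMod.val_cast_of_lt hm, ZMod.val_zero] at this
    omega
  rw [e1, ZMod.val_cast_of_lt (by omega)]
  constructor
  · rintro ⟨-, k, hk, rfl⟩
    exact ⟨k, by omega, by simp⟩
  · rintro ⟨k, hk, rfl⟩
    exact ⟨e2, k, by omega, by simp⟩

theorem IsHeight.add_natCast (hh : IsHeight w h) (X : ℤ) (m : ℕ) :
    h (X + m) = h X + m -
      2 * ((Finset.range m).filter fun t : ℕ => w ((X + t : ℤ) : ZMod n) = false).card := by
  induction m with
  | zero => simp
  | succ m ih =>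
    rw [Finset.range_add_one, Finset.filter_insert]
    have e : X + ((m + 1 : ℕ) : ℤ) = X + m + 1 := by push_cast; ring
    rw [e]
    rcases hh.succ_cases (X + m) with ⟨h1, h2⟩ | ⟨h1, h2⟩
    · rw [h2, ih, if_neg (by rw [h1]; simp)]
      push_cast; ring
    · rw [h2, ih, if_pos h1, Finset.card_insert_of_notMem (by simp)]
      push_cast; ring

/-- The change of the height over a cyclic interval in terms of the number of letters
`false`. -/
theorem IsHeight.add_eq_ncard [NeZero n] (hh : IsHeight w h) {X : ℤ} {m : ℕ} {x y : ZMod n}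
    (hm : m < n) (hx : (X : ZMod n) = x) (hy : ((X + m - 1 : ℤ) : ZMod n) = y) :
    h (X + m) = h X + m - 2 * (({z | w z = false} ∩ cycInterval x y).ncard : ℤ) := by
  subst hx hy
  rw [hh.add_natCast, cycInterval_eq_image X hm]
  congr 3
  have : ({z | w z = false} ∩
      (((Finset.range m).image fun t : ℕ => ((X + t : ℤ) : ZMod n) : Finset (ZMod n)) :
        Set (ZMod n))) =
      ((((Finset.range m).filter fun t : ℕ => w ((X + t : ℤ) : ZMod n) = false).image
        fun t : ℕ => ((X + t : ℤ) : ZMod n) : Finset (ZMod n)) : Set (ZMod n)) := by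
    ext z
    simp only [Set.mem_inter_iff, Set.mem_ofPred_eq, Finset.coe_image, Set.mem_image,
      Finset.mem_coe, Finset.mem_filter, Finset.mem_range]
    constructor
    · rintro ⟨h1, t, h2, rfl⟩
      exact ⟨t, ⟨h2, h1⟩, rfl⟩
    · rintro ⟨t, ⟨h2, h1⟩, rfl⟩
      exact ⟨h1, t, h2, rfl⟩
  rw [this, Set.ncard_coe_finset, Finset.card_image_of_injOn]
  exact (int_shift_injOn X hm.le).mono (Finset.coe_subset.2 (Finset.filter_subset _ _))

theorem toggle_toggle (w : ZMod n → Bool) (a b : ZMod n) : toggle (toggle w a b) a b = w := by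
  funext z
  simp only [toggle]
  cases w z <;> cases decide (z = a) <;> cases decide (z = b) <;> rfl

/-- Strictly between the toggled positions the steps agree. This transfers letter counts in the
source of a move to heights of its target. -/
theorem IsHeight.sub_eq_of_toggle [NeZero n] {h' : ℤ → ℤ} {I : ℤ} {L : ℕ} (hh : IsHeight w h)
    (hL : L < n) (hh' : IsHeight (toggle w (I : ZMod n) ((I + L : ℤ) : ZMod n)) h') {z : ℤ}
    (h1 : I + 1 ≤ z) (h2 : z ≤ I + L) : h' z = h z + (h' (I + 1) - h (I + 1)) := by
  induction z, h1 using Int.leInduction with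
  | base => ring
  | succ z hz ih =>
    have e1 : (z : ZMod n) ≠ I := by
      intro e
      obtain ⟨t, ht⟩ := exists_shift e
      have := shift_eq_zero ht (by omega) (by omega)
      subst this; omega
    have e2 : (z : ZMod n) ≠ ((I + L : ℤ) : ZMod n) := by
      intro e
      obtain ⟨t, ht⟩ := exists_shift e
      have := shift_eq_zero ht (by omega) (by omega)
      subst this; omega
    rw [hh z, hh' z, ih (by omega), toggle_of_ne e1 e2]
    ring

/-- The conditions on a move of the second kind describe matched pairs. -/
theorem matched_toggle_iff [NeZero n] {i j : ZMod n} (hi : w i = false) (hj : w j = true) :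
    Matched (toggle w i j) i j ↔
      Odd (rep (j - i)) ∧ (w (i + 1) = true ∧ w (j - 1) = false) ∧
      (∀ k : ℕ, 1 ≤ k → 2 * k + 3 ≤ rep (j - i) →
        k ≤ ({z | w z = false} ∩ cycInterval (j - 1 - 2 * (k : ZMod n)) (j - 2)).ncard) ∧
      (j ≠ i + 1 →
        2 * ({z | w z = false} ∩ cycInterval (i + 2) (j - 2)).ncard + 3 = rep (j - i)) := by
  have hn : 0 < n := Nat.pos_of_ne_zero (NeZero.ne n)
  have hij : i ≠ j := (ne_of_letters hj hi).symm
  obtain ⟨I, rfl⟩ := ZMod.intCast_surjective i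
  obtain ⟨L, hLdef⟩ : ∃ L, L = rep (j - (I : ZMod n)) := ⟨_, rfl⟩
  have hL0 : 0 < L := hLdef ▸ rep_pos _
  have hLn : L < n := hLdef ▸ rep_lt (sub_ne_zero.2 hij.symm)
  have hJ : j = ((I + L : ℤ) : ZMod n) := by
    rw [hLdef]; push_cast; rw [cast_rep]; ring
  rw [← hLdef]
  obtain ⟨g, hg⟩ := exists_isHeight w
  obtain ⟨h, hh⟩ := exists_isHeight (toggle w (I : ZMod n) j)
  have hvi : toggle w (I : ZMod n) j I = true := by rw [toggle_left hij, hi]; rfl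
  have hvj : toggle w (I : ZMod n) j j = false := by rw [toggle_right hij, hj]; rfl
  have diff : ∀ z, I + 1 ≤ z → z ≤ I + L → h z = g z + (h (I + 1) - g (I + 1)) := by
    intro z h1 h2
    rw [hJ] at hh
    exact hg.sub_eq_of_toggle hLn hh h1 h2
  -- Condition (d) for `k` thus means that the height at `j - 1 - 2k` is at least the height at `j -
  -- 1`; likewise (e) means that the heights at `i + 2` and `j - 1` agree.
  have cnt : ∀ k : ℕ, 2 * k + 3 ≤ L → h (I + L - 1) = h (I + L - 1 - 2 * k) + 2 * k -
      2 * (({z | w z = false} ∩ cycInterval (j - 1 - 2 * (k : ZMod n)) (j - 2)).ncard : ℤ) := by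
    intro k hk
    have h1 := hg.add_eq_ncard (X := I + L - 1 - 2 * k) (m := 2 * k) (x := j - 1 - 2 * (k : ZMod n))
      (y := j - 2) (by omega) (by rw [hJ]; push_cast; ring) (by rw [hJ]; push_cast; ring)
    rw [show I + L - 1 - 2 * (k : ℤ) + ((2 * k : ℕ) : ℤ) = I + L - 1 by push_cast; ring] at h1
    rw [diff _ (by omega) (by omega), diff (I + L - 1 - 2 * k) (by omega) (by omega), h1]
    push_cast; ring
  have cnt' : 3 ≤ L → h (I + L - 1) = h (I + 2) + (L - 3) -
      2 * (({z | w z = false} ∩ cycInterval ((I : ZMod n) + 2) (j - 2)).ncard : ℤ) := by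
    intro hL
    have e : ((L - 3 : ℕ) : ℤ) = L - 3 := by omega
    have h1 := hg.add_eq_ncard (X := I + 2) (m := L - 3) (x := (I : ZMod n) + 2)
      (y := j - 2) (by omega) (by push_cast; ring) (by rw [hJ, e]; push_cast; ring)
    rw [show I + 2 + ((L - 3 : ℕ) : ℤ) = I + L - 1 by omega] at h1
    rw [diff _ (by omega) (by omega), diff (I + 2) (by omega) (by omega), h1, e]
    ring
  have hne1 : L ≠ 1 → j ≠ (I : ZMod n) + 1 := by
    intro h1 e
    apply h1
    rw [hLdef, e, add_sub_cancel_left, ← Nat.cast_one, rep_eq one_pos (by omega)]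
  have hne2 : L ≠ 1 → (I : ZMod n) + 1 ≠ I := by
    intro h1 e
    have e1 : (1 : ZMod n) = 0 := by simpa using e
    have e2 : rep (1 : ZMod n) = 1 := by
      rw [← Nat.cast_one, rep_eq one_pos (by omega)]
    rw [e1] at e2
    simp [rep] at e2
    omega
  constructor
  · intro hm
    obtain ⟨D, hD, ha⟩ := hm.lift_left hh
    have hDL : D = I + L := by
      obtain ⟨t, ht⟩ := exists_shift (hJ.symm.trans hD.symm)
      have h1 := ha.lt
      have h2 := ha.lt_add hh hn
      have := shift_eq_zero ht (by omega) (by omega)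
      subst this; omega
    subst hDL
    have e1 := ha.eq
    have e2 := hh.succ_true (ha.left hh)
    have e3 := hh.succ_false (ha.right hh)
    have odd : Odd L := by
      have p1 := hh.parity (I + L + 1)
      have p2 := hh.parity I
      rw [Nat.odd_iff]
      omega
    have hodd := Nat.odd_iff.1 odd
    have hb : w ((I : ZMod n) + 1) = true ∧ w (j - 1) = false := by
      by_cases hL1 : L = 1
      · have e : j = (I : ZMod n) + 1 := by rw [hJ, hL1]; simp
        rw [e, add_sub_cancel_right, ← e]
        exact ⟨hj, hi⟩
      · rcases hm.inner with h1 | ⟨h1, h2⟩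
        · exact absurd h1 (hne1 hL1)
        · rw [toggle_of_ne (hne2 hL1) (hne1 hL1).symm] at h1
          rw [toggle_of_ne] at h2
          · exact ⟨h1, h2⟩
          · intro e; exact hne1 hL1 (by rw [← e]; ring)
          · intro e
            apply hne2 hL1
            have : (1 : ZMod n) = 0 := by linear_combination -e
            rw [this, add_zero]
    have hJ1 : 3 ≤ L → h (I + L - 1) = h I + 2 := by
      intro hL
      have := diff (I + L - 1) (by omega) (by omega)
      have := diff (I + L) (by omega) (by omega)
      have h3 := hg.succ_false (z := I + L - 1) (by
        rw [← hb.2, hJ]; push_cast; rfl)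
      rw [sub_add_cancel] at h3
      omega
    have hI2 : 3 ≤ L → h (I + 2) = h I + 2 := by
      intro hL
      have := diff (I + 1) (by omega) (by omega)
      have := diff (I + 2) (by omega) (by omega)
      have h3 := hg.succ_true (z := I + 1) (by rw [← hb.1]; push_cast; rfl)
      rw [show I + 1 + 1 = I + 2 by ring] at h3
      omega
    refine ⟨odd, hb, fun k hk1 hk2 => ?_, fun hne => ?_⟩
    · have h1 := cnt k hk2
      have h2 := ha.above (I + L - 1 - 2 * k) (by omega) (by omega)
      have p1 := hh.parity (I + L - 1 - 2 * k)
      have p2 := hh.parity I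
      have := hJ1 (by omega)
      omega
    · have hL : 3 ≤ L := by
        have : L ≠ 1 := by
          rintro rfl
          apply hne
          rw [hJ]; simp
        omega
      have h1 := cnt' hL
      have := hJ1 hL
      have := hI2 hL
      omega
  · rintro ⟨odd, hb, hd, he⟩
    have hodd := Nat.odd_iff.1 odd
    by_cases hL1 : L = 1
    · have e : j = (I : ZMod n) + 1 := by rw [hJ, hL1]; simp
      rw [e] at hvi hvj ⊢
      exact matched_succ hvi hvj
    have hL : 3 ≤ L := by omega
    have he' := he (hne1 hL1)
    have c1 := cnt' hL
    have e2 := hh.succ_true hvi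
    have e3 := hh.succ_false (z := I + L) (by rw [← hJ]; exact hvj)
    have d1 := diff (I + 1) (by omega) (by omega)
    have d2 := diff (I + 2) (by omega) (by omega)
    have d3 := diff (I + L - 1) (by omega) (by omega)
    have d4 := diff (I + L) (by omega) (by omega)
    have h3 := hg.succ_false (z := I + L - 1) (by rw [← hb.2, hJ]; push_cast; rfl)
    rw [sub_add_cancel] at h3
    have h4 := hg.succ_true (z := I + 1) (by rw [← hb.1]; push_cast; rfl)
    rw [show I + 1 + 1 = I + 2 by ring] at h4
    -- Condition (d) controls every second point, and `k = 0` is covered by (b) and (e). The points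
    -- in between are at most one step lower, which keeps them above `h I`.
    have even : ∀ k : ℕ, 2 * k + 3 ≤ L → h I + 2 ≤ h (I + L - 1 - 2 * k) := by
      intro k hk
      rcases Nat.eq_zero_or_pos k with rfl | h0
      · simp; omega
      · have := hd k h0 hk
        have := cnt k hk
        omega
    rw [hJ] at hh ⊢
    refine Matched.of_arc hh ⟨by omega, by omega, fun z h5 h6 => ?_⟩
    by_cases hz1 : z = I + 1
    · subst hz1; omega
    by_cases hz2 : z = I + L
    · subst hz2; omega
    obtain ⟨r, hr⟩ : ∃ r : ℕ, (r : ℤ) = I + L - 1 - z := ⟨(I + L - 1 - z).toNat, by omega⟩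
    rcases Nat.even_or_odd' r with ⟨k, hk | hk⟩
    · have := even k (by omega)
      rw [show I + L - 1 - 2 * (k : ℤ) = z by omega] at this
      omega
    · have := even k (by omega)
      rw [show I + L - 1 - 2 * (k : ℤ) = z + 1 by omega] at this
      rcases hh.succ_cases z with h7 | h7 <;> omega

end

/-! ### Tableaux as words -/

/-- Every finite set of residue classes is the set of entries of an increasing row. -/
theorem exists_increasing_row {n m : ℕ} [NeZero n] (A : Finset (ZMod n)) (hA : A.card = m) :
    ∃ f : Fin m → ZMod n, StrictMono (fun k => rep (f k)) ∧ Set.range f = A := by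
  have hc : (A.image rep).card = m := by
    rw [Finset.card_image_of_injective _ rep_injective, hA]
  have hmem : ∀ k, ∃ x ∈ A, rep x = (A.image rep).orderEmbOfFin hc k := fun k =>
    Finset.mem_image.1 ((A.image rep).orderEmbOfFin_mem hc k)
  choose f hf hf' using hmem
  have hmono : StrictMono (fun k => rep (f k)) := by
    intro x y hxy
    simp only [hf']
    exact ((A.image rep).orderEmbOfFin hc).strictMono hxy
  refine ⟨f, hmono, ?_⟩
  have hinj : Function.Injective f := fun x y e => hmono.injective (congrArg rep e)
  have : Finset.univ.image f = A := by
    apply Finset.eq_of_subset_of_card_le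
    · intro x hx
      obtain ⟨k, -, rfl⟩ := Finset.mem_image.1 hx
      exact hf k
    · rw [Finset.card_image_of_injective _ hinj, hA]; simp
  rw [← this]; simp

namespace RSYT

variable {n a b : ℕ} {s t : RSYT n a b} {i j : ZMod n}

open Classical in
/-- The word of a tableau: `true` marks the entries of the first row. -/
noncomputable def word (s : RSYT n a b) : ZMod n → Bool := fun z => decide (z ∈ s.row₁)

theorem word_eq_true : s.word i = true ↔ i ∈ s.row₁ := by simp [word]

theorem word_eq_false : s.word i = false ↔ i ∈ s.row₂ := by
  simp only [word, decide_eq_false_iff_not]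
  constructor
  · intro h
    obtain ⟨k | k, hk⟩ := s.bijective.2 i
    · exact absurd ⟨k, hk⟩ h
    · exact ⟨k, hk⟩
  · rintro ⟨l, hl⟩ ⟨k, hk⟩
    have := s.bijective.1 (a₁ := Sum.inl k) (a₂ := Sum.inr l) (by simp [hk, hl])
    cases this

theorem setOf_word_eq_false (s : RSYT n a b) : {z | s.word z = false} = s.row₂ := by
  ext z; exact word_eq_false

theorem mem_affineDes : i ∈ s.affineDes ↔ s.word i = true ∧ s.word (i + 1) = false := by
  rw [word_eq_true, word_eq_false]; rfl

theorem ext_row [NeZero n] (h1 : s.row₁ = t.row₁) (h2 : s.row₂ = t.row₂) : s = t := by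
  have aux : ∀ {m : ℕ} {f g : Fin m → ZMod n}, StrictMono (fun k => rep (f k)) →
      StrictMono (fun k => rep (g k)) → Set.range f = Set.range g → f = g := by
    intro m f g hf hg hfg
    have : Set.range (fun k => rep (f k)) = Set.range (fun k => rep (g k)) := by
      rw [← Function.comp_def, ← Function.comp_def, Set.range_comp, Set.range_comp, hfg]
    funext k
    exact rep_injective (congrFun ((hf.range_inj hg).1 this) k)
  exact RSYT.ext (aux s.first_increasing t.first_increasing h1)
    (aux s.second_increasing t.second_increasing h2)

theorem word_injective [NeZero n] : Function.Injective (word : RSYT n a b → ZMod n → Bool) := by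
  intro s t h
  apply ext_row
  · ext z; rw [← word_eq_true, ← word_eq_true, h]
  · ext z; rw [← word_eq_false, ← word_eq_false, h]

theorem interchange_iff (hi : s.word i = false) (hj : s.word j = true) :
    Interchange s t i j ↔ t.word = toggle s.word i j := by
  have hij : i ≠ j := (ne_of_letters hj hi).symm
  have key : ∀ z, s.word (Equiv.swap i j z) = toggle s.word i j z := by
    intro z
    by_cases h1 : z = i
    · subst h1; rw [Equiv.swap_apply_left, toggle_left hij, hi, hj]; rfl
    by_cases h2 : z = j
    · subst h2; rw [Equiv.swap_apply_right, toggle_right hij, hi, hj]; rfl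
    rw [Equiv.swap_apply_of_ne_of_ne h1 h2, toggle_of_ne h1 h2]
  unfold Interchange
  rw [Equiv.image_eq_preimage_symm, Equiv.image_eq_preimage_symm, Equiv.symm_swap]
  constructor
  · rintro ⟨h1, -⟩
    funext z
    rw [← key, Bool.eq_iff_iff, word_eq_true, word_eq_true, h1]; rfl
  · intro h
    constructor
    · ext z
      rw [← word_eq_true, h, ← key, word_eq_true]; rfl
    · ext z
      rw [← word_eq_false, h, ← key, word_eq_false]; rfl

/-- Interchanging an entry of the first row with one of the second row yields a tableau. -/
theorem exists_word_eq_toggle [NeZero n] (s : RSYT n a b) (hi : s.word i = false)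
    (hj : s.word j = true) : ∃ t : RSYT n a b, t.word = toggle s.word i j := by
  classical
  have hinj1 : Function.Injective s.first := fun x y e =>
    s.first_increasing.injective (congrArg rep e)
  have hinj2 : Function.Injective s.second := fun x y e =>
    s.second_increasing.injective (congrArg rep e)
  obtain ⟨f, hf, hf'⟩ := exists_increasing_row (m := a)
    (Finset.univ.image (Equiv.swap i j ∘ s.first)) (by
      rw [Finset.card_image_of_injective _ ((Equiv.injective _).comp hinj1)]; simp)
  obtain ⟨g, hg, hg'⟩ := exists_increasing_row (m := b)
    (Finset.univ.image (Equiv.swap i j ∘ s.second)) (by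
      rw [Finset.card_image_of_injective _ ((Equiv.injective _).comp hinj2)]; simp)
  have e1 : Set.range f = Equiv.swap i j '' s.row₁ := by
    rw [hf', row₁, ← Set.range_comp]; simp [Function.comp_def]
  have e2 : Set.range g = Equiv.swap i j '' s.row₂ := by
    rw [hg', row₂, ← Set.range_comp]; simp [Function.comp_def]
  have hcompl : s.row₁ᶜ = s.row₂ := by
    ext z
    rw [Set.mem_compl_iff, ← word_eq_true, ← word_eq_false, Bool.not_eq_true]
  refine ⟨⟨f, g, hf, hg, ?_, ?_⟩, ?_⟩
  · refine Function.Injective.sumElim (fun x y e => hf.injective (congrArg rep e))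
      (fun x y e => hg.injective (congrArg rep e)) fun x y e => ?_
    have h1 : f x ∈ Equiv.swap i j '' s.row₁ := e1 ▸ Set.mem_range_self x
    have h2 : f x ∈ Equiv.swap i j '' s.row₂ := e ▸ e2 ▸ Set.mem_range_self y
    rw [← hcompl, Set.image_compl_eq (Equiv.bijective _)] at h2
    exact h2 h1
  · rw [← Set.range_eq_univ, Set.Sum.elim_range, e1, e2, ← Set.image_union, ← hcompl,
      Set.union_compl_self, Set.image_univ]
    exact (Equiv.surjective _).range_eq
  · exact (interchange_iff hi hj).1 ⟨e1, e2⟩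

/-- There is a move between two tableaux. -/
def Move (s t : RSYT n a b) : Prop := FirstMove s t ∨ SecondMove s t

theorem firstMove_iff : FirstMove s t ↔
    ∃ i, s.word i = true ∧ s.word (i + 1) = false ∧ t.word = toggle s.word i (i + 1) := by
  unfold FirstMove
  refine exists_congr fun i => ?_
  rw [word_eq_true, word_eq_false]
  refine and_congr_right fun h1 => and_congr_right fun h2 => ?_
  rw [toggle_comm, ← interchange_iff (word_eq_false.2 h2) (word_eq_true.2 h1)]
  unfold Interchange
  rw [Equiv.swap_comm]

/-- By `matched_toggle_iff`, conditions (a), (b), (d) and (e) become a single matched pair in the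
target; only (c) and the exclusion `i ≠ j + 1` remain. -/
theorem secondMove_iff [NeZero n] : SecondMove s t ↔
    ∃ i j, Matched t.word i j ∧ s.word = toggle t.word i j ∧ i ≠ j + 1 ∧
      (s.word (i - 1) = true ∨ s.word (j + 1) = false) := by
  unfold SecondMove
  refine exists_congr fun i => exists_congr fun j => ?_
  rw [← setOf_word_eq_false, word_eq_true, word_eq_false]
  constructor
  · rintro ⟨h1, h2, h3, h4, h5, h6, h7, h8, h9⟩
    replace h1 : s.word i = false := h1
    rw [← word_eq_true] at h2
    rw [interchange_iff h1 h2] at h4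
    refine ⟨?_, by rw [h4, toggle_toggle], h3, ?_⟩
    · rw [h4]
      refine (matched_toggle_iff h1 h2).2 ⟨h5, ⟨word_eq_true.2 h6.1, h6.2⟩, h8, h9⟩
    · exact h7.imp id word_eq_false.1
  · rintro ⟨h1, h2, h3, h4⟩
    have hi : s.word i = false := by rw [h2, toggle_left h1.ne, h1.left]; rfl
    have hj : s.word j = true := by rw [h2, toggle_right h1.ne, h1.right]; rfl
    have h2' : t.word = toggle s.word i j := by rw [h2, toggle_toggle]
    rw [h2'] at h1
    obtain ⟨h5, h6, h7, h8⟩ := (matched_toggle_iff hi hj).1 h1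
    exact ⟨hi, word_eq_true.1 hj, h3, (interchange_iff hi hj).2 h2', h5,
      ⟨word_eq_true.1 h6.1, h6.2⟩, h4.imp id word_eq_false.2, h7, h8⟩

/-- The moves that remove a given descent. -/
theorem move_iff_cap [NeZero n] (hn : 1 < n) (hs : i ∈ s.affineDes) (ht : i ∉ t.affineDes) :
    Move s t ↔ Cap i t.word s.word := by
  have : Fact (1 < n) := ⟨hn⟩
  have hii : i ≠ i + 1 := by simp
  rw [mem_affineDes] at hs ht
  unfold Move
  rw [firstMove_iff, secondMove_iff]
  constructor
  · rintro (⟨x, h1, h2, h3⟩ | ⟨c, d, h1, h2, h3, h4⟩)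
    · have hx : x = i := by
        by_contra hne
        have hne' : i + 1 ≠ x + 1 := fun e => hne (add_right_cancel e).symm
        rw [h3] at ht
        rw [toggle_of_ne (Ne.symm hne) (ne_of_letters hs.1 h2),
          toggle_of_ne (ne_of_letters h1 hs.2).symm hne'] at ht
        exact ht hs
      subst hx
      have h4 : s.word = toggle t.word x (x + 1) := by rw [h3, toggle_toggle]
      rw [h4]
      apply Cap.valley
      · rw [h3, toggle_left hii, h1]; rfl
      · rw [h3, toggle_right hii, h2]; rfl
    · have hc : s.word c = false := by rw [h2, toggle_left h1.ne, h1.left]; rfl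
      have hd : s.word d = true := by rw [h2, toggle_right h1.ne, h1.right]; rfl
      have h2' : t.word = toggle s.word c d := by rw [h2, toggle_toggle]
      -- The descent `i` can disappear only if one of its letters is toggled. As `s` closes at `c`
      -- and opens at `d`, this means `i = d` or `i + 1 = c`.
      by_cases hid : i = d
      · subst hid
        rw [h2]
        refine Cap.down c ?_ h1
        rw [h2', toggle_of_ne h3.symm hii.symm, hs.2]
      · by_cases hic : i + 1 = c
        · subst hic
          rw [h2]
          refine Cap.up d ?_ h1
          rw [h2', toggle_of_ne hii hid, hs.1]
        · rw [h2', toggle_of_ne (ne_of_letters hs.1 hc) hid,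
            toggle_of_ne hic (ne_of_letters hd hs.2).symm] at ht
          exact absurd hs ht
  · intro hc
    generalize hw : s.word = w at hc
    cases hc with
    | valley h1 h2 =>
      left
      refine ⟨i, ?_, ?_, ?_⟩
      · rw [← hw]; exact hs.1
      · rw [← hw]; exact hs.2
      · rw [toggle_toggle]
    | up k h1 h2 =>
      right
      refine ⟨i + 1, k, h2, rfl, ?_, ?_⟩
      · intro e
        exact ne_of_letters h1 h2.right (add_right_cancel e)
      -- Condition (c) holds because of the descent `i` itself.
      · left
        rw [← hw, add_sub_cancel_right]; exact hs.1
    | down k h1 h2 =>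
      right
      refine ⟨k, i, h2, rfl, ne_of_letters h2.left h1, ?_⟩
      right
      rw [← hw]; exact hs.2

end RSYT

/-! ### Caps at adjacent positions -/

section

variable {n : ℕ} {v u : ZMod n → Bool} {i j : ZMod n}

/-- The neighbours in the cycle of residue classes. -/
def CycAdj (i j : ZMod n) : Prop := j = i + 1 ∨ i = j + 1

theorem CycAdj.symm (h : CycAdj i j) : CycAdj j i := Or.symm h

/-- With `ne_add_one`, this makes three consecutive positions distinct, as the local computations
below require. -/
theorem ne_add_two (hn : 3 ≤ n) (i : ZMod n) : i ≠ i + 1 + 1 := by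
  intro e
  have e2 : ((2 : ℕ) : ZMod n) = 0 := by push_cast; linear_combination -e
  rw [ZMod.natCast_eq_zero_iff] at e2
  have := Nat.le_of_dvd (by norm_num) e2
  omega

theorem ne_add_one (hn : 3 ≤ n) (i : ZMod n) : i ≠ i + 1 := by
  have : Fact (1 < n) := ⟨by omega⟩
  simp

/-- Only three consecutive letters matter. For `j = i + 1` the cap at `j` turns `()(` into `(()` and
`())` into `)()`, and the cap at `i` undoes this; the other side is symmetric. -/
theorem Cap.symm_of_adj (hn : 3 ≤ n) (hij : CycAdj i j) (h1 : u i = true) (h2 : u (i + 1) = false)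
    (hc : Cap j u v) : Cap i v u := by
  rcases hij with rfl | rfl
  · have n1 := ne_add_one hn i
    have n2 := ne_add_one hn (i + 1)
    have n3 := ne_add_two hn i
    cases hc with
    | valley h3 h4 =>
      have hm : Matched (toggle u (i + 1) (i + 1 + 1)) (i + 1) (i + 1 + 1) := by
        apply matched_succ
        · rw [toggle_left n2, h2]; rfl
        · rw [toggle_right n2, h4]; rfl
      have := Cap.up (i := i) _ (by rw [toggle_of_ne n1 n3, h1]) hm
      rwa [toggle_toggle] at this
    | up k h3 h4 => rw [h2] at h3; cases h3
    | down k h3 h4 =>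
      obtain rfl : i = k := (matched_succ h1 h2).left_unique h4
      have := Cap.valley (i := i) (v := toggle u i (i + 1)) (by rw [toggle_left n1, h1]; rfl)
        (by rw [toggle_right n1, h2]; rfl)
      rwa [toggle_toggle] at this
  · have n1 := ne_add_one hn j
    have n2 := ne_add_one hn (j + 1)
    have n3 := ne_add_two hn j
    cases hc with
    | valley h3 h4 =>
      have hm : Matched (toggle u j (j + 1)) j (j + 1) := by
        apply matched_succ
        · rw [toggle_left n1, h3]; rfl
        · rw [toggle_right n1, h4]; rfl
      have := Cap.down (i := j + 1) _ (by rw [toggle_of_ne n3.symm n2.symm, h2]) hm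
      rwa [toggle_toggle] at this
    | up k h3 h4 =>
      obtain rfl : j + 1 + 1 = k := (matched_succ h1 h2).right_unique h4
      have := Cap.valley (i := j + 1) (v := toggle u (j + 1) (j + 1 + 1))
        (by rw [toggle_left n2, h1]; rfl) (by rw [toggle_right n2, h2]; rfl)
      rwa [toggle_toggle] at this
    | down k h3 h4 => rw [h1] at h3; cases h3

/-- The descent at `i` supplies the mate needed at `j`, so the cap is defined. The opposite letters
at `c` and `d` ensure that the row lengths are preserved. -/
theorem Cap.exists_of_adj (hij : CycAdj i j) (h1 : u i = true) (h2 : u (i + 1) = false) :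
    ∃ c d, u c = false ∧ u d = true ∧ Cap j u (toggle u c d) := by
  have hm := matched_succ h1 h2
  rcases hij with rfl | rfl
  · cases h3 : u (i + 1 + 1)
    · refine ⟨i + 1, i, h2, h1, ?_⟩
      rw [toggle_comm]
      exact Cap.down i h3 hm
    · exact ⟨i + 1, i + 1 + 1, h2, h3, Cap.valley h2 h3⟩
  · cases h3 : u j
    · exact ⟨j, j + 1, h3, h1, Cap.valley h3 h1⟩
    · refine ⟨j + 1 + 1, j + 1, h2, h1, ?_⟩
      rw [toggle_comm]
      exact Cap.up _ h3 hm

end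

namespace RSYT

variable {n a b : ℕ} {s t u : RSYT n a b} {i j : ZMod n}

theorem notMem_affineDes_of_adj (hij : CycAdj i j) (hi : i ∈ s.affineDes) : j ∉ s.affineDes := by
  rw [mem_affineDes] at hi ⊢
  rintro ⟨h1, h2⟩
  rcases hij with rfl | rfl
  · rw [hi.2] at h1; cases h1
  · rw [hi.1] at h2; cases h2

/-- Every tableau with descent `i` has exactly one neighbour with descent `j`, where `i` and `j`
are adjacent. -/
theorem existsUnique_cap_of_adj [NeZero n] (s : RSYT n a b) (hij : CycAdj i j) (hs : i ∈ s.affineDes) :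
    ∃! t : RSYT n a b, Cap j s.word t.word := by
  rw [mem_affineDes] at hs
  obtain ⟨c, d, hc, hd, h⟩ := Cap.exists_of_adj hij hs.1 hs.2
  obtain ⟨t, ht⟩ := s.exists_word_eq_toggle hc hd
  refine ⟨t, show Cap j s.word t.word from ht ▸ h, fun t' ht' => ?_⟩
  apply word_injective
  rw [ht]
  exact ht'.unique h

theorem cap_iff_of_adj (hn : 3 ≤ n) (hij : CycAdj i j) (hs : i ∈ s.affineDes)
    (ht : j ∈ t.affineDes) : Cap j s.word t.word ↔ Cap i t.word s.word := by
  rw [mem_affineDes] at hs ht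
  exact ⟨fun h => h.symm_of_adj hn hij hs.1 hs.2, fun h => h.symm_of_adj hn hij.symm ht.1 ht.2⟩

/-- Caps of tableaux are tableaux. -/
theorem exists_word_of_cap [NeZero n] {y : ZMod n → Bool} (h : Cap i s.word y) :
    ∃ t : RSYT n a b, t.word = y := by
  cases h with
  | valley h1 h2 => exact s.exists_word_eq_toggle h1 h2
  | up k h1 h2 => rw [toggle_comm]; exact s.exists_word_eq_toggle h2.right h2.left
  | down k h1 h2 => rw [toggle_comm]; exact s.exists_word_eq_toggle h2.right h2.left

theorem cap_comm [NeZero n] (hij : i ≠ j) (hadj : ¬ CycAdj i j) (h : Cap i s.word t.word)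
    (h' : Cap j t.word u.word) :
    ∃ y : RSYT n a b, Cap j s.word y.word ∧ Cap i y.word u.word := by
  have hn : 0 < n := Nat.pos_of_ne_zero (NeZero.ne n)
  obtain ⟨y, h1, h2⟩ := Cap.comm hn (fun e => hadj (Or.inl e.symm)) (fun e => hadj (Or.inr e.symm))
    hij h h'
  obtain ⟨y', rfl⟩ := exists_word_of_cap h1
  exact ⟨y', h1, h2⟩

end RSYT

/-! ### Products of simple reflections -/

section

variable {n : ℕ} (hn : 3 ≤ n) (i j : ZMod n)

theorem simpleReflection_mul_self : simpleReflection hn i * simpleReflection hn i = 1 := by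
  apply Subtype.ext
  ext x
  exact simpleReflectionFun_involutive hn i x

theorem simpleReflection_mul_apply (x : ℤ) :
    ((simpleReflection hn i * simpleReflection hn j : affineSymmetricGroup n) : Equiv.Perm ℤ) x =
      simpleReflectionFun n i (simpleReflectionFun n j x) := rfl

theorem simpleReflection_mul_ne_one {i j : ZMod n} (hij : i ≠ j) :
    simpleReflection hn i * simpleReflection hn j ≠ 1 := by
  intro e
  have e1 : simpleReflection hn j = simpleReflection hn i := by
    have := congrArg (simpleReflection hn i * ·) e
    simpa [← mul_assoc, simpleReflection_mul_self] using this
  obtain ⟨I, rfl⟩ := ZMod.intCast_surjective i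
  have e2 : simpleReflectionFun n j I = simpleReflectionFun n (I : ZMod n) I :=
    congrArg (fun g : affineSymmetricGroup n => (g : Equiv.Perm ℤ) I) e1
  simp only [simpleReflectionFun, if_true, if_neg hij] at e2
  split_ifs at e2 <;> omega

/-- The product is the 3-cycle `x ↦ x + 1 ↦ x + 2 ↦ x` on each block starting at some `x ≡ i`, and
fixes everything else. -/
theorem orderOf_simpleReflection_mul_succ :
    orderOf (simpleReflection hn i * simpleReflection hn (i + 1)) = 3 := by
  have n1 := ne_add_one hn i
  have n2 := ne_add_one hn (i + 1)
  have n3 := ne_add_two hn i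
  refine orderOf_eq_prime ?_ (simpleReflection_mul_ne_one hn n1)
  have k1 : ∀ x : ℤ, (x : ZMod n) = i →
      simpleReflectionFun n i (simpleReflectionFun n (i + 1) x) = x + 1 := fun x h => by
    simp [simpleReflectionFun, h, n1, n3]
  have k2 : ∀ x : ℤ, (x : ZMod n) = i + 1 →
      simpleReflectionFun n i (simpleReflectionFun n (i + 1) x) = x + 1 := fun x h => by
    simp [simpleReflectionFun, h, n2.symm, n3.symm]
  have k3 : ∀ x : ℤ, (x : ZMod n) = i + 1 + 1 →
      simpleReflectionFun n i (simpleReflectionFun n (i + 1) x) = x - 2 := fun x h => by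
    simp [simpleReflectionFun, h, n1.symm, n2.symm]
    ring
  apply Subtype.ext
  ext x
  rw [pow_three]
  change simpleReflectionFun n i (simpleReflectionFun n (i + 1) (simpleReflectionFun n i
    (simpleReflectionFun n (i + 1) (simpleReflectionFun n i
    (simpleReflectionFun n (i + 1) x))))) = x
  by_cases h1 : (x : ZMod n) = i
  · rw [k1 x h1, k2 (x + 1) (by simp [h1]), k3 (x + 1 + 1) (by simp [h1])]
    ring
  by_cases h2 : (x : ZMod n) = i + 1
  · rw [k2 x h2, k3 (x + 1) (by simp [h2]), k1 (x + 1 - 2) (by push_cast; rw [h2]; ring)]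
    ring
  by_cases h3 : (x : ZMod n) = i + 1 + 1
  · rw [k3 x h3, k1 (x - 2) (by push_cast; rw [h3]; ring), k2 (x - 2 + 1) (by push_cast; rw [h3]; ring)]
    ring
  · simp [simpleReflectionFun, h1, h2, h3]

theorem orderOf_simpleReflection_mul_symm :
    orderOf (simpleReflection hn i * simpleReflection hn j) =
      orderOf (simpleReflection hn j * simpleReflection hn i) := by
  have hinv : ∀ k, (simpleReflection hn k)⁻¹ = simpleReflection hn k := fun k =>
    inv_eq_of_mul_eq_one_left (simpleReflection_mul_self hn k)
  rw [← orderOf_inv, mul_inv_rev, hinv, hinv]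

theorem orderOf_simpleReflection_mul_of_adj {i j : ZMod n} (h : CycAdj i j) :
    orderOf (simpleReflection hn i * simpleReflection hn j) = 3 := by
  rcases h with rfl | rfl
  · exact orderOf_simpleReflection_mul_succ hn i
  · rw [orderOf_simpleReflection_mul_symm]
    exact orderOf_simpleReflection_mul_succ hn j

theorem orderOf_simpleReflection_mul_of_not_adj {i j : ZMod n} (hij : i ≠ j)
    (h : ¬ CycAdj i j) : orderOf (simpleReflection hn i * simpleReflection hn j) = 2 := by
  have n1 := ne_add_one hn i
  have n2 := ne_add_one hn j
  have h1 : j ≠ i + 1 := fun e => h (Or.inl e)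
  have h2 : i ≠ j + 1 := fun e => h (Or.inr e)
  have h3 : i + 1 ≠ j + 1 := fun e => hij (add_right_cancel e)
  have hcomm : simpleReflection hn i * simpleReflection hn j =
      simpleReflection hn j * simpleReflection hn i := by
    apply Subtype.ext
    ext x
    rw [simpleReflection_mul_apply, simpleReflection_mul_apply]
    by_cases c1 : (x : ZMod n) = i
    · simp [simpleReflectionFun, c1, hij, h2, h1.symm]
    by_cases c2 : (x : ZMod n) = i + 1
    · simp [simpleReflectionFun, c2, hij, h2, h1.symm, n1.symm]
    by_cases c3 : (x : ZMod n) = j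
    · simp [simpleReflectionFun, c3, hij.symm, h2.symm, h1]
    by_cases c4 : (x : ZMod n) = j + 1
    · simp [simpleReflectionFun, c4, hij.symm, h2.symm, h1, n2.symm]
    · simp [simpleReflectionFun, c1, c2, c3, c4]
  refine orderOf_eq_prime ?_ (simpleReflection_mul_ne_one hn hij)
  rw [pow_two]
  nth_rewrite 2 [hcomm]
  rw [mul_assoc, ← mul_assoc (simpleReflection hn j), simpleReflection_mul_self, one_mul,
    simpleReflection_mul_self]

end

/-! ### Matrix form of the `W`-graph relations -/

section

variable {V R : Type*} [Fintype V] [CommRing R]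

/-- The operator on the free module on `V` sending a basis element `u` to
`∑ v, M u v • v`. -/
noncomputable def rowOperator (M : Matrix V V R) : Module.End R (V →₀ R) :=
  Finsupp.linearCombination R fun u => ∑ v, M u v • Finsupp.single v (1 : R)

theorem rowOperator_single (M : Matrix V V R) (u : V) :
    rowOperator M (Finsupp.single u 1) = ∑ v, M u v • Finsupp.single v (1 : R) := by
  simp [rowOperator]

theorem rowOperator_mul (M N : Matrix V V R) :
    rowOperator M * rowOperator N = rowOperator (N * M) := by
  refine Finsupp.lhom_ext' fun u => LinearMap.ext_ring ?_
  simp only [LinearMap.comp_apply, Module.End.mul_apply, Finsupp.lsingle_apply]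
  rw [rowOperator_single, rowOperator_single, map_sum]
  simp only [map_smul, rowOperator_single, Finset.smul_sum, smul_smul, Matrix.mul_apply,
    Finset.sum_smul]
  exact Finset.sum_comm

theorem rowOperator_smul (c : R) (M : Matrix V V R) : rowOperator (c • M) = c • rowOperator M := by
  refine Finsupp.lhom_ext' fun u => LinearMap.ext_ring ?_
  simp [rowOperator_single, Finset.smul_sum]

/-- The Hecke quadratic relation in terms of `A = T - q`. -/
theorem hecke_quadratic {A : Type*} [Ring A] [Algebra R A] (q : R) (x : A)
    (hx : x * x = -(1 + q) • x) :
    (x + algebraMap R A q - algebraMap R A q) * (x + algebraMap R A q + 1) = 0 := by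
  rw [add_sub_cancel_right, mul_add, mul_add, hx, mul_one, ← Algebra.commutes,
    ← Algebra.smul_def]
  module

/-- The braid relation in terms of `A = T - q`, when both sides of the Temperley–Lieb relation
vanish. -/
theorem hecke_braid {A : Type*} [Ring A] [Algebra R A] (q : R) (x y : A)
    (hx : x * x = -(1 + q) • x) (hy : y * y = -(1 + q) • y)
    (hxyx : x * y * x = q • x) (hyxy : y * x * y = q • y) :
    (x + algebraMap R A q) * ((y + algebraMap R A q) * (x + algebraMap R A q)) =
      (y + algebraMap R A q) * ((x + algebraMap R A q) * (y + algebraMap R A q)) := by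
  have hq : ∀ z : A, z * algebraMap R A q = q • z := fun z => by
    rw [← Algebra.commutes, ← Algebra.smul_def]
  simp only [add_mul, mul_add, hq, ← Algebra.smul_def, smul_add, mul_smul_comm, smul_mul_assoc,
    ← mul_assoc, hxyx, hyxy, hx, hy]
  module

end

namespace LabeledGraph

variable {I V : Type*} [Fintype V] [DecidableEq V] (Γ : LabeledGraph I V)

open Classical in
/-- The diagonal matrix indicating the vertices with `i` in their label. -/
noncomputable def labelMatrix (i : I) : Matrix V V QRing :=
  Matrix.diagonal fun u => if i ∈ Γ.τ u then 1 else 0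

open Classical in
/-- The weights of the edges that remove `i` from the label. -/
noncomputable def edgeMatrix (i : I) : Matrix V V QRing := fun u v =>
  if i ∈ Γ.τ u ∧ i ∉ Γ.τ v then Γ.m u v else 0

/-- The matrix of `T_i - q`. -/
noncomputable def shiftedMatrix (i : I) : Matrix V V QRing :=
  -(1 + qVar) • Γ.labelMatrix i + qHalf • Γ.edgeMatrix i

theorem qHalf_mul_qHalf : qHalf * qHalf = qVar := by
  rw [qHalf, qVar, ← LaurentPolynomial.T_add]; norm_num

/-- Subtracting `q` kills the vertices without label `i` and turns the diagonal entry `-1` of the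
others into `-(1 + q)`. -/
theorem operator_eq (i : I) :
    Γ.operator i = rowOperator (Γ.shiftedMatrix i) + algebraMap QRing _ qVar := by
  classical
  refine Finsupp.lhom_ext' fun u => LinearMap.ext_ring ?_
  simp only [LinearMap.comp_apply, Finsupp.lsingle_apply, LinearMap.add_apply,
    Module.algebraMap_end_apply, rowOperator_single]
  rw [operator, Finsupp.linearCombination_single, one_smul, actOnVertex]
  have e1 : ∑ v, Γ.shiftedMatrix i u v • Finsupp.single v (1 : QRing) =
      (-(1 + qVar) * if i ∈ Γ.τ u then 1 else 0) • Finsupp.single u (1 : QRing) +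
        qHalf • ∑ v, Γ.edgeMatrix i u v • Finsupp.single v (1 : QRing) := by
    simp only [shiftedMatrix, Matrix.add_apply, Matrix.smul_apply, add_smul, smul_eq_mul,
      Finset.sum_add_distrib, Finset.smul_sum, smul_smul]
    congr 1
    rw [Finset.sum_eq_single u]
    · simp [labelMatrix]
    · intro v _ hv
      simp [labelMatrix, Matrix.diagonal_apply_ne _ hv.symm]
    · simp
  rw [e1]
  by_cases hi : i ∈ Γ.τ u
  · have e2 : ∑ᶠ (v : V) (_ : i ∉ Γ.τ v), Γ.m u v • Finsupp.single v (1 : QRing) =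
        ∑ v, Γ.edgeMatrix i u v • Finsupp.single v (1 : QRing) := by
      rw [finsum_eq_sum_of_fintype]
      refine Finset.sum_congr rfl fun v _ => ?_
      by_cases hv : i ∈ Γ.τ v
      · simp [edgeMatrix, hv]
      · simp [edgeMatrix, hv, hi]
    rw [if_pos hi, if_pos hi, e2]
    module
  · have e2 : ∀ v, Γ.edgeMatrix i u v = 0 := fun v => by simp [edgeMatrix, hi]
    rw [if_neg hi, if_neg hi]
    simp [e2]

theorem labelMatrix_mul_self (i : I) : Γ.labelMatrix i * Γ.labelMatrix i = Γ.labelMatrix i := by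
  rw [labelMatrix, Matrix.diagonal_mul_diagonal]
  congr 1
  funext u
  split_ifs <;> simp

theorem labelMatrix_mul_comm (i j : I) :
    Γ.labelMatrix i * Γ.labelMatrix j = Γ.labelMatrix j * Γ.labelMatrix i := by
  rw [labelMatrix, labelMatrix, Matrix.diagonal_mul_diagonal, Matrix.diagonal_mul_diagonal]
  congr 1
  funext u
  exact mul_comm _ _

theorem labelMatrix_mul_edgeMatrix (i : I) :
    Γ.labelMatrix i * Γ.edgeMatrix i = Γ.edgeMatrix i := by
  ext u v
  rw [labelMatrix, Matrix.diagonal_mul, edgeMatrix]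
  split_ifs <;> simp_all

theorem edgeMatrix_mul_labelMatrix (i : I) : Γ.edgeMatrix i * Γ.labelMatrix i = 0 := by
  ext u v
  rw [labelMatrix, Matrix.mul_diagonal, edgeMatrix]
  split_ifs <;> simp_all

theorem edgeMatrix_mul_self (i : I) : Γ.edgeMatrix i * Γ.edgeMatrix i = 0 := by
  rw [← Γ.labelMatrix_mul_edgeMatrix, ← mul_assoc, mul_assoc (Γ.labelMatrix i),
    edgeMatrix_mul_labelMatrix]
  simp

/-- Edges counted by `E` start at label `i` and end off it, so `L² = L`, `L E = E`, `E L = 0` and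
`E² = 0`. The relation holds for every labeled graph. -/
theorem shiftedMatrix_mul_self (i : I) :
    Γ.shiftedMatrix i * Γ.shiftedMatrix i = -(1 + qVar) • Γ.shiftedMatrix i := by
  simp only [shiftedMatrix, add_mul, mul_add, Matrix.smul_mul, Matrix.mul_smul,
    labelMatrix_mul_self, labelMatrix_mul_edgeMatrix, edgeMatrix_mul_labelMatrix,
    edgeMatrix_mul_self, smul_zero, add_zero, smul_add, smul_comm qHalf]

/-- `Γ` satisfies the relations of commuting generators if the edges are compatible with the
labels and the two ways of removing `i` and `j` from a label have the same weight. -/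
theorem shiftedMatrix_comm {i j : I}
    (h1 : ∀ u v, Γ.m u v ≠ 0 → i ∈ Γ.τ u → i ∉ Γ.τ v → j ∈ Γ.τ v → j ∈ Γ.τ u)
    (h2 : ∀ u v, Γ.m u v ≠ 0 → j ∈ Γ.τ u → j ∉ Γ.τ v → i ∈ Γ.τ v → i ∈ Γ.τ u)
    (h3 : Γ.edgeMatrix i * Γ.edgeMatrix j = Γ.edgeMatrix j * Γ.edgeMatrix i) :
    Γ.shiftedMatrix i * Γ.shiftedMatrix j = Γ.shiftedMatrix j * Γ.shiftedMatrix i := by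
  -- The two sides can differ only on an edge that trades one of the labels `i`, `j` for the other,
  -- which `h1` and `h2` exclude.
  have key : Γ.labelMatrix i * Γ.edgeMatrix j + Γ.edgeMatrix i * Γ.labelMatrix j =
      Γ.labelMatrix j * Γ.edgeMatrix i + Γ.edgeMatrix j * Γ.labelMatrix i := by
    ext u v
    simp only [Matrix.add_apply]
    rw [labelMatrix, labelMatrix, Matrix.diagonal_mul, Matrix.diagonal_mul, Matrix.mul_diagonal,
      Matrix.mul_diagonal, edgeMatrix, edgeMatrix]
    by_cases hm : Γ.m u v = 0
    · simp [hm]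
    · have h1' := h1 u v hm
      have h2' := h2 u v hm
      by_cases a1 : i ∈ Γ.τ u <;> by_cases a2 : j ∈ Γ.τ u <;> by_cases a3 : i ∈ Γ.τ v <;>
        by_cases a4 : j ∈ Γ.τ v <;> simp_all
  simp only [shiftedMatrix, add_mul, mul_add, Matrix.smul_mul, Matrix.mul_smul, h3,
    Γ.labelMatrix_mul_comm i j]
  linear_combination (norm := module) (-(1 + qVar) * qHalf) • key

/-- `Γ` satisfies the Temperley–Lieb relation if the edges between the vertices with label `i`
and those with label `j` form a pair of mutually inverse matrices. -/
theorem shiftedMatrix_braid {i j : I} (h1 : ∀ u, i ∈ Γ.τ u → j ∉ Γ.τ u)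
    (h2 : Γ.edgeMatrix i * Γ.labelMatrix j * (Γ.edgeMatrix j * Γ.labelMatrix i) =
      Γ.labelMatrix i) :
    Γ.shiftedMatrix i * Γ.shiftedMatrix j * Γ.shiftedMatrix i = qVar • Γ.shiftedMatrix i := by
  have hij : Γ.labelMatrix i * Γ.labelMatrix j = 0 := by
    rw [labelMatrix, labelMatrix, Matrix.diagonal_mul_diagonal]
    ext u v
    by_cases huv : u = v
    · subst huv
      have := h1 u
      simp only [Matrix.diagonal_apply_eq, Matrix.zero_apply]
      split_ifs <;> simp_all
    · simp [Matrix.diagonal_apply_ne _ huv]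
  have hji : Γ.labelMatrix j * Γ.labelMatrix i = 0 := by rw [labelMatrix_mul_comm, hij]
  have hl : ∀ k, Γ.shiftedMatrix k = Γ.labelMatrix k * Γ.shiftedMatrix k := fun k => by
    simp only [shiftedMatrix, mul_add, Matrix.mul_smul, labelMatrix_mul_self,
      labelMatrix_mul_edgeMatrix]
  have e1 : Γ.shiftedMatrix i * Γ.labelMatrix j = qHalf • (Γ.edgeMatrix i * Γ.labelMatrix j) := by
    rw [shiftedMatrix, add_mul, Matrix.smul_mul, Matrix.smul_mul, hij, smul_zero, zero_add]
  have e2 : Γ.shiftedMatrix j * Γ.labelMatrix i = qHalf • (Γ.edgeMatrix j * Γ.labelMatrix i) := by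
    rw [shiftedMatrix, add_mul, Matrix.smul_mul, Matrix.smul_mul, hji, smul_zero, zero_add]
  -- Since `A_k = L_k A_k`, label matrices may be inserted between the factors; as `L_i L_j = 0`,
  -- they remove the diagonal parts and leave only edges between the two label classes.
  calc Γ.shiftedMatrix i * Γ.shiftedMatrix j * Γ.shiftedMatrix i
      = (Γ.shiftedMatrix i * Γ.labelMatrix j) * (Γ.shiftedMatrix j * Γ.labelMatrix i) *
          Γ.shiftedMatrix i := by
        simp only [mul_assoc]
        rw [← hl i, ← mul_assoc (Γ.labelMatrix j), ← hl j]
    _ = qVar • Γ.shiftedMatrix i := by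
        rw [e1, e2, Matrix.smul_mul, Matrix.mul_smul, smul_smul, qHalf_mul_qHalf, h2,
          Matrix.smul_mul, ← hl i]

end LabeledGraph

/-! ### The matrix relations for the two-row graph -/

theorem affineTwoRowGraph_m {n a b : ℕ} (u v : RSYT n a b) [Decidable (RSYT.Move u v)] :
    (affineTwoRowGraph n a b).m u v = if RSYT.Move u v then 1 else 0 := by
  by_cases h : RSYT.Move u v
  · rw [if_pos h]; exact if_pos h
  · rw [if_neg h]; exact if_neg h

section

variable {n a b : ℕ} [NeZero n] {i j : ZMod n}

open Classical in
theorem edgeMatrix_affineTwoRowGraph (hn : 3 ≤ n) (u v : RSYT n a b) :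
    (affineTwoRowGraph n a b).edgeMatrix i u v = if Cap i v.word u.word then 1 else 0 := by
  unfold LabeledGraph.edgeMatrix
  rw [affineTwoRowGraph_m]
  change (if i ∈ u.affineDes ∧ i ∉ v.affineDes then _ else _) = _
  by_cases h : i ∈ u.affineDes ∧ i ∉ v.affineDes
  · rw [if_pos h]
    simp only [RSYT.move_iff_cap (by omega : 1 < n) h.1 h.2]
  · rw [if_neg h, if_neg]
    intro hc
    apply h
    rw [RSYT.mem_affineDes, RSYT.mem_affineDes]
    exact ⟨hc.descent (ne_add_one hn i), hc.not_descent⟩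

theorem descent_of_edge (hn : 3 ≤ n) (hadj : ¬ CycAdj i j) (u v : RSYT n a b)
    (hm : (affineTwoRowGraph n a b).m u v ≠ 0) (h1 : i ∈ u.affineDes) (h2 : i ∉ v.affineDes)
    (h3 : j ∈ v.affineDes) : j ∈ u.affineDes := by
  classical
  have hmove : RSYT.Move u v := by
    by_contra h
    rw [affineTwoRowGraph_m, if_neg h] at hm
    exact hm rfl
  rw [RSYT.move_iff_cap (by omega) h1 h2] at hmove
  rw [RSYT.mem_affineDes] at h3 ⊢
  exact hmove.descent_of_ne (fun e => hadj (Or.inl e.symm)) (fun e => hadj (Or.inr e.symm)) h3.1 h3.2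

variable [Fintype (RSYT n a b)]

/-- Since `Cap` is a partial function, an entry of the product counts at most one intermediate
tableau. Existence of that tableau is symmetric in the two positions by `RSYT.cap_comm`. -/
theorem edgeMatrix_mul_comm (hn : 3 ≤ n) (hij : i ≠ j) (hadj : ¬ CycAdj i j) :
    (affineTwoRowGraph n a b).edgeMatrix i * (affineTwoRowGraph n a b).edgeMatrix j =
      (affineTwoRowGraph n a b).edgeMatrix j * (affineTwoRowGraph n a b).edgeMatrix i := by
  classical
  have key : ∀ (i j : ZMod n) (u w : RSYT n a b),
      ((affineTwoRowGraph n a b).edgeMatrix i * (affineTwoRowGraph n a b).edgeMatrix j) u w =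
        if ∃ v : RSYT n a b, Cap j w.word v.word ∧ Cap i v.word u.word then 1 else 0 := by
    intro i j u w
    rw [Matrix.mul_apply]
    simp only [edgeMatrix_affineTwoRowGraph hn]
    split_ifs with h
    · obtain ⟨v, h1, h2⟩ := h
      rw [Finset.sum_eq_single v, if_pos h1, if_pos h2, one_mul]
      · intro v' _ hv'
        rw [if_neg (c := Cap j w.word v'.word), mul_zero]
        intro h3
        exact hv' (RSYT.word_injective (h3.unique h1))
      · simp
    · refine Finset.sum_eq_zero fun v _ => ?_
      by_cases h1 : Cap i v.word u.word
      · rw [if_neg (c := Cap j w.word v.word), mul_zero]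
        exact fun h2 => h ⟨v, h2, h1⟩
      · rw [if_neg h1, zero_mul]
  refine Matrix.ext fun u w => ?_
  rw [key, key]
  refine if_congr ?_ rfl rfl
  constructor
  · rintro ⟨v, h1, h2⟩
    exact RSYT.cap_comm hij.symm (fun h => hadj h.symm) h1 h2
  · rintro ⟨v, h1, h2⟩
    exact RSYT.cap_comm hij hadj h1 h2

variable [DecidableEq (RSYT n a b)]

open Classical in
-- Reversing the cap by `RSYT.cap_iff_of_adj` exhibits the matrix as the graph of the function `Cap
-- j` on the tableaux with descent `i`.
theorem edgeMatrix_mul_labelMatrix_of_adj (hn : 3 ≤ n) (hij : CycAdj i j) (u v : RSYT n a b) :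
    ((affineTwoRowGraph n a b).edgeMatrix i * (affineTwoRowGraph n a b).labelMatrix j) u v =
      if i ∈ u.affineDes ∧ Cap j u.word v.word then 1 else 0 := by
  rw [LabeledGraph.labelMatrix, Matrix.mul_diagonal, edgeMatrix_affineTwoRowGraph hn]
  change _ * (if j ∈ v.affineDes then _ else _) = _
  by_cases h : i ∈ u.affineDes ∧ j ∈ v.affineDes
  · rw [if_pos h.2, mul_one]
    simp only [h.1, true_and, RSYT.cap_iff_of_adj hn hij h.1 h.2]
  · rw [if_neg (c := _ ∧ _)]
    · by_cases h1 : Cap i v.word u.word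
      · have hi := RSYT.mem_affineDes.2 (h1.descent (ne_add_one hn i))
        rw [if_neg (c := j ∈ v.affineDes), mul_zero]
        exact fun hj => h ⟨hi, hj⟩
      · rw [if_neg h1, zero_mul]
    · rintro ⟨h1, h2⟩
      exact h ⟨h1, RSYT.mem_affineDes.2 (h2.descent (ne_add_one hn j))⟩

theorem edgeMatrix_inverse_of_adj (hn : 3 ≤ n) (hij : CycAdj i j) :
    (affineTwoRowGraph n a b).edgeMatrix i * (affineTwoRowGraph n a b).labelMatrix j *
      ((affineTwoRowGraph n a b).edgeMatrix j * (affineTwoRowGraph n a b).labelMatrix i) =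
      (affineTwoRowGraph n a b).labelMatrix i := by
  classical
  refine Matrix.ext fun u w => ?_
  rw [Matrix.mul_apply]
  simp only [edgeMatrix_mul_labelMatrix_of_adj hn hij,
    edgeMatrix_mul_labelMatrix_of_adj hn hij.symm]
  rw [LabeledGraph.labelMatrix, Matrix.diagonal_apply]
  change _ = if u = w then (if i ∈ u.affineDes then _ else _) else _
  by_cases hu : i ∈ u.affineDes
  · obtain ⟨v, hv, hv'⟩ := u.existsUnique_cap_of_adj hij hu
    have hvj : j ∈ v.affineDes := RSYT.mem_affineDes.2 (hv.descent (ne_add_one hn j))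
    have hback := (RSYT.cap_iff_of_adj hn hij hu hvj).1 hv
    rw [Finset.sum_eq_single v, if_pos ⟨hu, hv⟩, one_mul, if_pos hu]
    · refine if_congr ?_ rfl rfl
      constructor
      · rintro ⟨-, h⟩
        exact RSYT.word_injective (hback.unique h)
      · rintro rfl
        exact ⟨hvj, hback⟩
    · intro v' _ hne
      rw [if_neg, zero_mul]
      exact fun h => hne (hv' v' h.2)
    · simp
  · simp [hu]

end

theorem mainTheorem1 (n a b : ℕ) (hn : 3 ≤ n) (hb : 1 ≤ b) (hba : b ≤ a) (hab : a + b = n) :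
    (affineTwoRowGraph n a b).IsWGraph (simpleReflection hn) := by
  classical
  have : NeZero n := ⟨by omega⟩
  have := RSYT.finite n a b
  have : Fintype (RSYT n a b) := Fintype.ofFinite _
  let Γ := affineTwoRowGraph n a b
  have quad : ∀ i, rowOperator (Γ.shiftedMatrix i) * rowOperator (Γ.shiftedMatrix i) =
      -(1 + qVar) • rowOperator (Γ.shiftedMatrix i) := fun i => by
    rw [rowOperator_mul, Γ.shiftedMatrix_mul_self, rowOperator_smul]
  have braid : ∀ i j, CycAdj i j → rowOperator (Γ.shiftedMatrix i) *
      rowOperator (Γ.shiftedMatrix j) * rowOperator (Γ.shiftedMatrix i) =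
      qVar • rowOperator (Γ.shiftedMatrix i) := fun i j hij => by
    -- `rowOperator` reverses products, which is harmless for the palindrome `i, j, i`.
    rw [rowOperator_mul, rowOperator_mul, ← mul_assoc, Γ.shiftedMatrix_braid
      (fun u hu => RSYT.notMem_affineDes_of_adj hij hu) (edgeMatrix_inverse_of_adj hn hij),
      rowOperator_smul]
  have hrel : ∀ ⦃x y : FreeAlgebra QRing (ZMod n)⦄, HeckeRel (simpleReflection hn) x y →
      FreeAlgebra.lift QRing Γ.operator x = FreeAlgebra.lift QRing Γ.operator y := by
    intro x y hxy
    cases hxy with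
    | quadratic i =>
      simp only [map_mul, map_sub, map_add, map_one, map_zero, FreeAlgebra.lift_ι_apply,
        AlgHom.commutes, Γ.operator_eq]
      exact hecke_quadratic (A := Module.End QRing (RSYT n a b →₀ QRing)) qVar _ (quad i)
    | braid i j =>
      by_cases hij : i = j
      · subst hij; rfl
      by_cases hadj : CycAdj i j
      · rw [orderOf_simpleReflection_mul_of_adj hn hadj]
        simp only [altProd, map_mul, mul_one, FreeAlgebra.lift_ι_apply, Γ.operator_eq]
        exact hecke_braid (A := Module.End QRing (RSYT n a b →₀ QRing)) qVar _ _ (quad i) (quad j)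
          (braid i j hadj) (braid j i hadj.symm)
      · rw [orderOf_simpleReflection_mul_of_not_adj hn hij hadj]
        simp only [altProd, map_mul, mul_one, FreeAlgebra.lift_ι_apply, Γ.operator_eq]
        have hcomm : Commute (rowOperator (Γ.shiftedMatrix i))
            (rowOperator (Γ.shiftedMatrix j)) := by
          rw [commute_iff_eq, rowOperator_mul, rowOperator_mul]
          rw [Γ.shiftedMatrix_comm (descent_of_edge hn hadj)
            (descent_of_edge hn fun h => hadj h.symm) (edgeMatrix_mul_comm hn hij hadj)]
        exact (hcomm.add_right (Algebra.commute_algebraMap_right _ _)).add_left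
          (Algebra.commute_algebraMap_left _ _)
  refine ⟨RingQuot.liftAlgHom QRing ⟨FreeAlgebra.lift QRing Γ.operator, hrel⟩, fun i => ?_⟩
  rw [heckeT, RingQuot.liftAlgHom_mkAlgHom_apply, FreeAlgebra.lift_ι_apply]
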